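/- An order $O$ in an imaginary quadratic field $K$ is called odd (resp. even) if its discriminant, i.e. the discriminant of the bilinear form $O\times O\to\mathbb Z$, $(a,b)\mapsto \mathrm{tr}_{K/\mathbb Q}(ab)$, is an odd (resp. even) integer. An elliptic curve $E$ over $\mathbb C$ has complex multiplication (CM) if its endomorphism ring $\mathrm{End}(E)$ is an order in an imaginary quadratic field; such an $E$ is called odd (resp. even) if the order $\mathrm{End}(E)$ is odd (resp. even). **Proposition.** Let $\phi: E_1\to E_2$ be an isogeny of elliptic curves with CM over $\mathbb C$. Suppose that $n=\deg(\phi)$ is an odd integer. Then $E_1$ is odd (resp. even) if and only if $E_2$ is odd (resp. even). In other words, $E_1$ and $E_2$ have the same parity. -/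

import Mathlib

noncomputable section

namespace ComplexEllipticCurve

open MvPolynomial WeierstrassCurve
open scoped WeierstrassCurve.Projective

/-! ### Morphisms of elliptic curves over `ℂ`

An elliptic curve over `ℂ` is a Weierstrass curve `E` with nonzero discriminant (`E.IsElliptic`).
Its group of complex points is `E.toProjective.Point`, a subset of the projective plane. -/

/-- The group of complex points of a Weierstrass curve in the projective plane. -/
abbrev Pt (E : WeierstrassCurve ℂ) : Type := E.toProjective.Point

/-- The vector `p ∈ ℂ³` is a vector of homogeneous coordinates of the point `P`. -/
def IsCoord {E : WeierstrassCurve ℂ} (p : Fin 3 → ℂ) (P : Pt E) : Prop :=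
  (⟦p⟧ : Projective.PointClass ℂ) = P.point

/-- The values at `p` of a triple of polynomials in three variables. -/
def evalTriple (F : Fin 3 → MvPolynomial (Fin 3) ℂ) (p : Fin 3 → ℂ) : Fin 3 → ℂ :=
  fun i => eval p (F i)

/-- `f` is regular at `P`: there are three homogeneous polynomials `F₀, F₁, F₂` of the same degree,
not all zero at `P`, such that `f(Q) = [F₀(Q) : F₁(Q) : F₂(Q)]` at all points `Q` in the Zariski
neighbourhood of `P` in which `F₀, F₁, F₂` do not vanish simultaneously. -/
def IsRegularAt {E₁ E₂ : WeierstrassCurve ℂ} (f : Pt E₁ → Pt E₂) (P : Pt E₁) : Prop :=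
  ∃ (d : ℕ) (F : Fin 3 → MvPolynomial (Fin 3) ℂ),
    (∀ i, (F i).IsHomogeneous d) ∧
    (∀ p, IsCoord p P → evalTriple F p ≠ 0) ∧
    ∀ (Q : Pt E₁) (q : Fin 3 → ℂ), IsCoord q Q → evalTriple F q ≠ 0 →
      IsCoord (evalTriple F q) (f Q)

/-- Morphisms of projective varieties: maps that are regular at every point. -/
def IsMorphism {E₁ E₂ : WeierstrassCurve ℂ} (f : Pt E₁ → Pt E₂) : Prop :=
  ∀ P, IsRegularAt f P

section Closure

/-! #### Morphisms into an elliptic curve can be added and composed -/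

variable {E₁ E₂ E₃ : WeierstrassCurve ℂ}

lemma exists_isCoord (P : Pt E₁) : ∃ p, IsCoord p P ∧ E₁.toProjective.Nonsingular p := by
  obtain ⟨p, hp⟩ := Quotient.exists_rep P.point
  have h := P.nonsingular
  rw [← hp] at h
  exact ⟨p, hp, h⟩

lemma IsCoord.nonsingular {p : Fin 3 → ℂ} {P : Pt E₁} (h : IsCoord p P) :
    E₁.toProjective.Nonsingular p := by
  have h1 := P.nonsingular
  rw [← h] at h1
  exact h1

lemma IsCoord.equiv_iff {p q : Fin 3 → ℂ} {P Q : Pt E₁} (hp : IsCoord p P) (hq : IsCoord q Q) :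
    p ≈ q ↔ P = Q := by
  rw [Projective.Point.ext_iff, ← hp, ← hq, Quotient.eq]

lemma ne_zero_of_nonsingular {p : Fin 3 → ℂ} (h : E₁.toProjective.Nonsingular p) : p ≠ 0 := by
  rintro rfl
  rw [Projective.nonsingular_iff] at h
  simp at h

lemma isRegularAt_id (P : Pt E₁) : IsRegularAt (fun Q : Pt E₁ => Q) P := by
  have he : ∀ q : Fin 3 → ℂ, evalTriple (fun i => X i) q = q := fun q => by
    funext i
    simp [evalTriple]
  refine ⟨1, fun i => X i, fun i => isHomogeneous_X _ _, fun p hp => ?_, fun Q q hq _ => ?_⟩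
  · rw [he]
    exact ne_zero_of_nonsingular hp.nonsingular
  · rwa [he]

lemma isRegularAt_const (T : Pt E₂) (P : Pt E₁) : IsRegularAt (fun _ : Pt E₁ => T) P := by
  obtain ⟨t, ht, htn⟩ := exists_isCoord T
  have he : ∀ q : Fin 3 → ℂ, evalTriple (fun i => C (t i)) q = t := fun q => by
    funext i
    simp [evalTriple]
  refine ⟨0, fun i => C (t i), fun i => isHomogeneous_C _ _, fun p hp => ?_, fun Q q hq _ => ?_⟩
  · rw [he]
    exact ne_zero_of_nonsingular htn
  · rwa [he]

lemma IsRegularAt.comp {g : Pt E₂ → Pt E₃} {f : Pt E₁ → Pt E₂} {P : Pt E₁}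
    (hg : IsRegularAt g (f P)) (hf : IsRegularAt f P) : IsRegularAt (fun Q => g (f Q)) P := by
  obtain ⟨d, F, hF, hF0, hFf⟩ := hf
  obtain ⟨e, G, hG, hG0, hGg⟩ := hg
  have he : ∀ q : Fin 3 → ℂ,
      evalTriple (fun i => aeval F (G i)) q = evalTriple G (evalTriple F q) := fun q => by
    funext i
    have h : (aeval F (G i)) = bind₁ F (G i) := rfl
    simp only [evalTriple, h]
    rw [eval, eval₂Hom_bind₁]
    rfl
  -- if `G` does not vanish at the zero vector, then it is a triple of constants
  have hc : evalTriple G 0 ≠ 0 → ∀ p q, evalTriple G p = evalTriple G q := by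
    intro h0 p q
    have he0 : e = 0 := by
      by_contra hne
      apply h0
      funext i
      have h : eval (0 : Fin 3 → ℂ) (G i) = coeff 0 (G i) := by
        rw [← constantCoeff_eq, ← eval_zero]
      simp only [evalTriple, Pi.zero_apply]
      rw [h]
      exact (hG i).coeff_eq_zero (by simpa using Ne.symm hne)
    subst he0
    funext i
    have h := (totalDegree_zero_iff_isHomogeneous (p := G i)).mpr (hG i)
    rw [totalDegree_eq_zero_iff_eq_C] at h
    simp only [evalTriple]
    rw [h]
    simp
  refine ⟨d * e, fun i => aeval F (G i), fun i => (hG i).aeval F hF, fun p hp => ?_,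
    fun Q q hq hne => ?_⟩
  · rw [he]
    exact hG0 _ (hFf P p hp (hF0 p hp))
  · rw [he] at hne ⊢
    by_cases hFq : evalTriple F q = 0
    · rw [hFq] at hne ⊢
      obtain ⟨r, hr, _⟩ := exists_isCoord (f Q)
      rw [hc hne 0 r]
      exact hGg (f Q) r hr (hc hne 0 r ▸ hne)
    · exact hGg _ _ (hFf Q q hq hFq) hne

lemma isRegularAt_neg {f : Pt E₁ → Pt E₂} {P : Pt E₁} (hf : IsRegularAt f P) :
    IsRegularAt (fun Q => -f Q) P := by
  obtain ⟨d, F, hF, hF0, hFf⟩ := hf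
  set W : Projective (MvPolynomial (Fin 3) ℂ) := E₂.toProjective.map C with hW
  have he : ∀ q : Fin 3 → ℂ,
      evalTriple (W.neg F) q = E₂.toProjective.neg (evalTriple F q) := fun q => by
    have h := Projective.map_neg (W' := W) (eval q) F
    have h2 : W.map (eval q) = E₂.toProjective := by
      rw [hW]; ext <;> simp [WeierstrassCurve.map]
    rw [h2] at h
    exact h.symm
  have hns : ∀ q, E₂.toProjective.neg (evalTriple F q) ≠ 0 → evalTriple F q ≠ 0 := by
    intro q hq h0
    apply hq
    rw [h0]
    funext i
    fin_cases i <;> simp [Projective.neg, Projective.negY]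
  have hco : ∀ Q q, IsCoord q Q → evalTriple F q ≠ 0 →
      IsCoord (E₂.toProjective.neg (evalTriple F q)) (-f Q) := by
    intro Q q hq h0
    have h := hFf Q q hq h0
    unfold IsCoord at h ⊢
    rw [Projective.Point.neg_point, ← h, Projective.negMap_eq]
  refine ⟨d, W.neg F, fun i => ?_, fun p hp => ?_, fun Q q hq hne => ?_⟩
  · fin_cases i
    · exact hF 0
    · change (W.negY F).IsHomogeneous d
      exact (((hF 1).neg).sub ((hF 0).C_mul E₂.a₁)).sub ((hF 2).C_mul E₂.a₃)
    · exact hF 2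
  · rw [he]
    exact ne_zero_of_nonsingular (hco P p hp (hF0 p hp)).nonsingular
  · rw [he] at hne ⊢
    exact hco Q q hq (hns q hne)

lemma isHomogeneous_addXYZ {F G : Fin 3 → MvPolynomial (Fin 3) ℂ} {d e : ℕ}
    (hF : ∀ i, (F i).IsHomogeneous d) (hG : ∀ i, (G i).IsHomogeneous e) (i : Fin 3) :
    ((E₂.toProjective.map C).addXYZ F G i).IsHomogeneous (2 * d + 2 * e) := by
  have m : ∀ (c : ℂ) (i j k l : Fin 3),
      (C c * (F i * F j * G k * G l)).IsHomogeneous (2 * d + 2 * e) := by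
    intro c i j k l
    have h := ((((hF i).mul (hF j)).mul (hG k)).mul (hG l)).C_mul c
    convert h using 1
    ring
  have hX : ((E₂.toProjective.map C).addX F G).IsHomogeneous (2 * d + 2 * e) := by
    have h := (m (-1) 0 2 1 1)
      |>.add (m (1) 1 1 0 2)
      |>.add (m (-2) 0 1 1 2)
      |>.add (m (2) 1 2 0 1)
      |>.add (m (-E₂.a₁) 0 0 1 2)
      |>.add (m (E₂.a₁) 1 2 0 0)
      |>.add (m (E₂.a₂) 0 0 0 2)
      |>.add (m (-E₂.a₂) 0 2 0 0)
      |>.add (m (-E₂.a₃) 0 1 2 2)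
      |>.add (m (E₂.a₃) 2 2 0 1)
      |>.add (m (-(2 * E₂.a₃)) 0 2 1 2)
      |>.add (m (2 * E₂.a₃) 1 2 0 2)
      |>.add (m (E₂.a₄) 0 0 2 2)
      |>.add (m (-E₂.a₄) 2 2 0 0)
      |>.add (m (3 * E₂.a₆) 0 2 2 2)
      |>.add (m (-(3 * E₂.a₆)) 2 2 0 2)
    convert h using 1
    simp only [Projective.addX, WeierstrassCurve.map, map_neg, map_mul, map_ofNat, map_one]
    ring
  have hY : ((E₂.toProjective.map C).negAddY F G).IsHomogeneous (2 * d + 2 * e) := by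
    have h := (m (-3) 0 0 0 1)
      |>.add (m (3) 0 1 0 0)
      |>.add (m (-1) 1 1 1 2)
      |>.add (m (1) 1 2 1 1)
      |>.add (m (E₂.a₁) 0 2 1 1)
      |>.add (m (-E₂.a₁) 1 1 0 2)
      |>.add (m (-E₂.a₂) 0 0 1 2)
      |>.add (m (E₂.a₂) 1 2 0 0)
      |>.add (m (2 * E₂.a₂) 0 1 0 2)
      |>.add (m (-(2 * E₂.a₂)) 0 2 0 1)
      |>.add (m (-E₂.a₃) 1 1 2 2)
      |>.add (m (E₂.a₃) 2 2 1 1)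
      |>.add (m (E₂.a₄) 0 1 2 2)
      |>.add (m (-(2 * E₂.a₄)) 0 2 1 2)
      |>.add (m (2 * E₂.a₄) 1 2 0 2)
      |>.add (m (-E₂.a₄) 2 2 0 1)
      |>.add (m (3 * E₂.a₆) 1 2 2 2)
      |>.add (m (-(3 * E₂.a₆)) 2 2 1 2)
    convert h using 1
    simp only [Projective.negAddY, WeierstrassCurve.map, map_neg, map_mul, map_ofNat, map_one]
    ring
  have hZ : ((E₂.toProjective.map C).addZ F G).IsHomogeneous (2 * d + 2 * e) := by
    have h := (m (-3) 0 0 0 2)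
      |>.add (m (3) 0 2 0 0)
      |>.add (m (1) 1 1 2 2)
      |>.add (m (-1) 2 2 1 1)
      |>.add (m (E₂.a₁) 0 1 2 2)
      |>.add (m (-E₂.a₁) 2 2 0 1)
      |>.add (m (-E₂.a₂) 0 0 2 2)
      |>.add (m (E₂.a₂) 2 2 0 0)
      |>.add (m (E₂.a₃) 1 2 2 2)
      |>.add (m (-E₂.a₃) 2 2 1 2)
      |>.add (m (-E₂.a₄) 0 2 2 2)
      |>.add (m (E₂.a₄) 2 2 0 2)
    convert h using 1
    simp only [Projective.addZ, WeierstrassCurve.map, map_neg, map_ofNat, map_one]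
    ring
  fin_cases i
  · exact hX
  · exact (((hY).neg).sub (hX.C_mul E₂.a₁)).sub (hZ.C_mul E₂.a₃)
  · exact hZ

lemma isRegularAt_add_of_ne {f g : Pt E₁ → Pt E₂} {P : Pt E₁} (hf : IsRegularAt f P)
    (hg : IsRegularAt g P) (hne : f P ≠ g P) : IsRegularAt (fun Q => f Q + g Q) P := by
  obtain ⟨d, F, hF, hF0, hFf⟩ := hf
  obtain ⟨e, G, hG, hG0, hGg⟩ := hg
  set W : Projective (MvPolynomial (Fin 3) ℂ) := E₂.toProjective.map C with hW
  have he : ∀ q : Fin 3 → ℂ, evalTriple (W.addXYZ F G) q =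
      E₂.toProjective.addXYZ (evalTriple F q) (evalTriple G q) := fun q => by
    have h := Projective.map_addXYZ (W' := W) (eval q) F G
    have h2 : W.map (eval q) = E₂.toProjective := by
      rw [hW]; ext <;> simp [WeierstrassCurve.map]
    rw [h2] at h
    exact h.symm
  have hco : ∀ Q q, IsCoord q Q → evalTriple F q ≠ 0 → evalTriple G q ≠ 0 → f Q ≠ g Q →
      IsCoord (E₂.toProjective.addXYZ (evalTriple F q) (evalTriple G q)) (f Q + g Q) := by
    intro Q q hq h1 h2 h3
    have k1 := hFf Q q hq h1
    have k2 := hGg Q q hq h2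
    have hn : ¬ evalTriple F q ≈ evalTriple G q := fun h => h3 ((k1.equiv_iff k2).mp h)
    unfold IsCoord at k1 k2 ⊢
    rw [Projective.Point.add_point, ← k1, ← k2, Projective.addMap_eq,
      Projective.add_of_not_equiv hn]
  refine ⟨2 * d + 2 * e, W.addXYZ F G, isHomogeneous_addXYZ hF hG, fun p hp => ?_,
    fun Q q hq hnz => ?_⟩
  · rw [he]
    exact ne_zero_of_nonsingular (hco P p hp (hF0 p hp) (hG0 p hp) hne).nonsingular
  · rw [he] at hnz ⊢
    have h1 : evalTriple F q ≠ 0 := by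
      intro h0
      apply hnz
      have h := E₂.toProjective.addXYZ_smul (evalTriple F q) (evalTriple G q) 0 1
      rw [h0] at h ⊢
      simpa using h
    have h2 : evalTriple G q ≠ 0 := by
      intro h0
      apply hnz
      have h := E₂.toProjective.addXYZ_smul (evalTriple F q) (evalTriple G q) 1 0
      rw [h0] at h ⊢
      simpa using h
    refine hco Q q hq h1 h2 fun h3 => hnz ?_
    obtain ⟨u, hu⟩ := ((hFf Q q hq h1).equiv_iff (hGg Q q hq h2)).mpr h3
    have hu' : (u : ℂ) • evalTriple G q = evalTriple F q := hu
    have h := E₂.toProjective.addXYZ_smul (evalTriple G q) (evalTriple G q) u 1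
    rw [one_smul, hu', Projective.addXYZ_self] at h
    rw [h]
    funext i
    fin_cases i <;> simp

lemma exists_affine_point (E : WeierstrassCurve ℂ) [E.IsElliptic] (A B : E.toAffine.Point) :
    ∃ T : E.toAffine.Point, T ≠ A ∧ T ≠ B ∧ T ≠ -T := by
  -- the abscissas to be avoided
  let x : E.toAffine.Point → ℂ := fun
    | .zero => 0
    | .some a _ _ => a
  have hne : E.twoTorsionPolynomial.toPoly ≠ 0 :=
    Cubic.ne_zero_of_a_ne_zero (by simp [twoTorsionPolynomial])
  obtain ⟨a, ha⟩ := Set.Infinite.nonempty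
    (Set.Finite.infinite_compl
      ((E.twoTorsionPolynomial.toPoly.rootSet_finite ℂ).union (Set.toFinite ({x A, x B} : Set ℂ))))
  simp only [Set.mem_compl_iff, Set.mem_union, Polynomial.mem_rootSet, Set.mem_insert_iff,
    Set.mem_singleton_iff, not_or, not_and] at ha
  obtain ⟨h1, h2, h3⟩ := ha
  obtain ⟨b, hb⟩ : ∃ b, E.toAffine.Equation a b := by
    obtain ⟨b, hb⟩ := IsAlgClosed.exists_root
      (Polynomial.C 1 * Polynomial.X ^ 2 + Polynomial.C (E.a₁ * a + E.a₃) * Polynomial.X +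
        Polynomial.C (-(a ^ 3 + E.a₂ * a ^ 2 + E.a₄ * a + E.a₆)))
      (by rw [Polynomial.degree_quadratic one_ne_zero]; norm_num)
    refine ⟨b, (Affine.equation_iff _ _).mpr ?_⟩
    simp only [Polynomial.IsRoot, Polynomial.eval_add, Polynomial.eval_mul, Polynomial.eval_C,
      Polynomial.eval_pow, Polynomial.eval_X] at hb
    linear_combination hb
  refine ⟨.some a b (Affine.equation_iff_nonsingular.mp hb), ?_, ?_, ?_⟩
  · rintro rfl
    exact h2 rfl
  · rintro rfl
    exact h3 rfl
  · intro h
    rw [Affine.Point.neg_some, Affine.Point.some.injEq] at h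
    apply h1 hne
    have hb2 := (Affine.equation_iff _ _).mp hb
    have hy := h.2
    rw [Affine.negY] at hy
    simp [Cubic.toPoly, twoTorsionPolynomial, b₂, b₄, b₆]
    linear_combination (-4) * hb2 + (2 * b + E.a₁ * a + E.a₃) * hy

lemma exists_point (E : WeierstrassCurve ℂ) [E.IsElliptic] (A B : Pt E) :
    ∃ T : Pt E, T ≠ A ∧ T ≠ B ∧ T ≠ -T := by
  classical
  let e := Projective.Point.toAffineAddEquiv E.toProjective
  obtain ⟨T, h1, h2, h3⟩ := exists_affine_point E (e A) (e B)
  refine ⟨e.symm T, ?_, ?_, ?_⟩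
  · rwa [Ne, AddEquiv.symm_apply_eq]
  · rwa [Ne, AddEquiv.symm_apply_eq]
  · rwa [← map_neg, Ne, e.symm.injective.eq_iff]

lemma isRegularAt_add [E₂.IsElliptic] {f g : Pt E₁ → Pt E₂} {P : Pt E₁} (hf : IsRegularAt f P)
    (hg : IsRegularAt g P) : IsRegularAt (fun Q => f Q + g Q) P := by
  by_cases hne : f P = g P
  · obtain ⟨T, h1, h2, h3⟩ := exists_point E₂ (f P) (-g P)
    have k1 : IsRegularAt (fun Q => f Q + T) P :=
      isRegularAt_add_of_ne hf (isRegularAt_const T P) (Ne.symm h1)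
    have k2 : IsRegularAt (fun Q => g Q + -T) P :=
      isRegularAt_add_of_ne hg (isRegularAt_const (-T) P) fun h => h2 (by rw [h, neg_neg])
    have k3 := isRegularAt_add_of_ne k1 k2 fun h => h3 (by simpa [hne] using h)
    have h : (fun Q => f Q + g Q) = fun Q => (f Q + T) + (g Q + -T) := by
      funext Q
      abel
    rw [h]
    exact k3
  · exact isRegularAt_add_of_ne hf hg hne

end Closure

/-! ### Endomorphism rings, isogenies and degrees -/

/-- The endomorphism ring of an elliptic curve `E` over `ℂ`: the group endomorphisms of `E(ℂ)` that
are morphisms of projective curves. Addition is pointwise, multiplication is composition. -/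
def End (E : WeierstrassCurve ℂ) [E.IsElliptic] : Subring (AddMonoid.End (Pt E)) where
  carrier := {f | IsMorphism f}
  mul_mem' hf hg := fun P => (hf _).comp (hg P)
  one_mem' := fun P => isRegularAt_id P
  add_mem' hf hg := fun P => isRegularAt_add (hf P) (hg P)
  zero_mem' := fun P => isRegularAt_const 0 P
  neg_mem' hf := fun P => isRegularAt_neg (hf P)

/-- An isogeny of elliptic curves: a nonzero homomorphism of algebraic groups. -/
structure Isogeny (E₁ E₂ : WeierstrassCurve ℂ) where
  /-- the map on complex points -/
  toHom : Pt E₁ →+ Pt E₂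
  isMorphism : IsMorphism toHom
  ne_zero : toHom ≠ 0

/-- The isogeny `φ : E₁ → E₂` has degree `n`: all but finitely many points of `E₂(ℂ)` have exactly
`n` preimages. -/
def Isogeny.HasDegree {E₁ E₂ : WeierstrassCurve ℂ} (φ : Isogeny E₁ E₂) (n : ℕ) : Prop :=
  {Q : Pt E₂ | (φ.toHom ⁻¹' {Q}).encard ≠ n}.Finite

/-! ### Orders in imaginary quadratic fields and parity -/

/-- `K` is an imaginary quadratic field. -/
def IsImaginaryQuadratic (K : Type) [Field K] [NumberField K] : Prop :=
  Module.finrank ℚ K = 2 ∧ NumberField.IsTotallyComplex K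

/-- The subring `O` is an order in the number field `K`: it is finitely generated as an abelian
group and spans `K` over `ℚ`. -/
def IsOrder {K : Type} [Field K] [NumberField K] (O : Subring K) : Prop :=
  Module.Finite ℤ O ∧ Submodule.span ℚ (O : Set K) = ⊤

/-- The integer `d` is the discriminant of the order `O` in the quadratic field `K`: the determinant
of the matrix of the trace form `(a, b) ↦ tr(ab)` in a `ℤ`-basis of `O`. -/
def HasDiscr {K : Type} [Field K] [NumberField K] (O : Subring K) (d : ℤ) : Prop :=
  ∃ b : Module.Basis (Fin 2) ℤ O, Algebra.discr ℚ (fun i => (b i : K)) = d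

/-- `E` has complex multiplication: `End(E)` is (isomorphic to) an order in an imaginary quadratic
field. -/
def HasCM (E : WeierstrassCurve ℂ) [E.IsElliptic] : Prop :=
  ∃ (K : Type) (_ : Field K) (_ : NumberField K) (O : Subring K),
    IsImaginaryQuadratic K ∧ IsOrder O ∧ Nonempty (End E ≃+* O)

/-- `E` is odd: `End(E)` is an order with odd discriminant in an imaginary quadratic field. -/
def IsOdd (E : WeierstrassCurve ℂ) [E.IsElliptic] : Prop :=
  ∃ (K : Type) (_ : Field K) (_ : NumberField K) (O : Subring K),
    IsImaginaryQuadratic K ∧ IsOrder O ∧ Nonempty (End E ≃+* O) ∧ ∃ d : ℤ, HasDiscr O d ∧ Odd d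

/-- `E` is even: `End(E)` is an order with even discriminant in an imaginary quadratic field. -/
def IsEven (E : WeierstrassCurve ℂ) [E.IsElliptic] : Prop :=
  ∃ (K : Type) (_ : Field K) (_ : NumberField K) (O : Subring K),
    IsImaginaryQuadratic K ∧ IsOrder O ∧ Nonempty (End E ≃+* O) ∧ ∃ d : ℤ, HasDiscr O d ∧ Even d

end ComplexEllipticCurve

end

noncomputable section

namespace ComplexEllipticCurve

/-! ### The parity of an order is a property of its reduction modulo 2 -/

/-! The parity of a quadratic order O can be read off from O/2O: the discriminant is the Gram
determinant of the trace form, and it is even exactly when O/2O has a nonzero element of square zero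
(`even_discr_of_hasSqZeroModTwo`, `hasSqZeroModTwo_of_even_discr`). This condition makes sense for
the abstract ring `End E`, so the field and the basis disappear from the problem.

Let ψ be the dual of φ, so that ψφ = n and φψ = n. If α² = 2β, then φαψ has square φαnαψ = 2φ(nβ)ψ.
If φαψ = 2γ, then n²α = 2ψγφ, and since n² is odd, α is itself divisible by 2. So α ↦ φαψ carries
nonzero square-zero classes modulo 2 from E₁ to E₂, and exchanging φ and ψ carries them back
(`HasSqZeroModTwo.of_dual`).

The bulk of the work is ψ. As a group homomorphism it exists because φ is surjective and its kernel,
of order n, is killed by n. That it is a morphism is `isMorphism_of_comp`: at the generic point of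
E₁ the coordinates of ψ∘φ depend only on those of φ. The function field is algebraic over the field
generated by the latter, so in characteristic zero Galois theory puts the former in that field
(`exists_aeval_mul_eq_of_forall`). The resulting rational formula for ψ holds at all but finitely
many points, and a homomorphism that is regular at one point is regular everywhere by translation.
-/

/-- `R / 2R` has a nonzero element with square zero. -/
def HasSqZeroModTwo (R : Type*) [Ring R] : Prop :=
  ∃ x : R, ¬ (2 : R) ∣ x ∧ (2 : R) ∣ x * x

lemma HasSqZeroModTwo.of_ringEquiv {R S : Type*} [Ring R] [Ring S] (e : R ≃+* S)
    (h : HasSqZeroModTwo R) : HasSqZeroModTwo S := by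
  obtain ⟨x, hx, y, hy⟩ := h
  refine ⟨e x, ?_, e y, ?_⟩
  · rintro ⟨z, hz⟩
    refine hx ⟨e.symm z, e.injective ?_⟩
    rw [hz, map_mul, map_ofNat, e.apply_symm_apply]
  · rw [← map_mul, hy, map_mul, map_ofNat]

/-! ### Rings of rank two over ℤ: the trace form modulo 2 -/

section RankTwo

variable {O : Type*} [CommRing O] (b : Module.Basis (Fin 2) ℤ O)

-- Cayley–Hamilton for the 2 × 2 matrix of multiplication by x; N is its determinant, the norm of x.
include b in
lemma exists_mul_self_eq (x : O) :
    ∃ N : ℤ, x * x = Algebra.trace ℤ O x • x - N • (1 : O) := by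
  refine ⟨(Algebra.leftMulMatrix b x).det, Algebra.leftMulMatrix_injective b ?_⟩
  rw [Algebra.trace_eq_matrix_trace b]
  simp only [map_mul, map_sub, map_zsmul, map_one]
  ext i j
  rw [Matrix.sub_apply, Matrix.smul_apply, Matrix.smul_apply, smul_eq_mul, smul_eq_mul]
  fin_cases i <;> fin_cases j <;>
    simp [Matrix.mul_apply, Fin.sum_univ_two, Matrix.trace_fin_two, Matrix.det_fin_two] <;> ring

-- By Cayley–Hamilton, tr(x²) = tr(x)² − 2N, so tr(x²) and tr(x)² agree modulo 2.
include b in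
lemma two_dvd_trace_of_two_dvd_trace_mul_self {x : O} (h : (2 : ℤ) ∣ Algebra.trace ℤ O (x * x)) :
    (2 : ℤ) ∣ Algebra.trace ℤ O x := by
  obtain ⟨N, hN⟩ := exists_mul_self_eq b x
  have h1 : Algebra.trace ℤ O (1 : O) = 2 := by
    have := Algebra.trace_algebraMap_of_basis b (1 : ℤ)
    simpa using this
  rw [hN, map_sub, map_zsmul, map_zsmul, h1] at h
  simp only [smul_eq_mul] at h
  have h2 : (2 : ℤ) ∣ Algebra.trace ℤ O x * Algebra.trace ℤ O x := by
    have := dvd_add h (Dvd.intro_left N rfl : (2 : ℤ) ∣ N * 2)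
    simpa using this
  rcases Int.prime_two.dvd_or_dvd h2 with h | h <;> exact h

lemma two_dvd_iff_repr (x : O) : (2 : O) ∣ x ↔ (2 : ℤ) ∣ b.repr x 0 ∧ (2 : ℤ) ∣ b.repr x 1 := by
  have h2 : ∀ y : O, 2 * y = (2 : ℤ) • y := fun y => by simp
  constructor
  · rintro ⟨y, rfl⟩
    rw [h2, map_zsmul]
    simp [-zsmul_eq_mul]
  · rintro ⟨⟨k, hk⟩, l, hl⟩
    refine ⟨k • b 0 + l • b 1, ?_⟩
    rw [← b.sum_repr x, Fin.sum_univ_two, hk, hl, h2, smul_add, smul_smul, smul_smul]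

lemma two_dvd_trace_of_two_dvd {x : O} (h : (2 : O) ∣ x) : (2 : ℤ) ∣ Algebra.trace ℤ O x := by
  obtain ⟨y, rfl⟩ := h
  have h2 : 2 * y = (2 : ℤ) • y := by simp
  rw [h2, map_zsmul]
  exact ⟨_, rfl⟩

lemma discr_fin_two : Algebra.discr ℤ b =
    Algebra.trace ℤ O (b 0 * b 0) * Algebra.trace ℤ O (b 1 * b 1) -
      Algebra.trace ℤ O (b 0 * b 1) * Algebra.trace ℤ O (b 0 * b 1) := by
  rw [Algebra.discr_def, Matrix.det_fin_two]
  simp [Algebra.traceMatrix_apply, Algebra.traceForm_apply, mul_comm (b 1) (b 0)]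

lemma trace_mul_eq (x y : O) : Algebra.trace ℤ O (x * y) =
    b.repr y 0 * Algebra.trace ℤ O (x * b 0) + b.repr y 1 * Algebra.trace ℤ O (x * b 1) := by
  conv_lhs => rw [← b.sum_repr y, Fin.sum_univ_two, mul_add, mul_smul_comm, mul_smul_comm,
    map_add, map_zsmul, map_zsmul, smul_eq_mul, smul_eq_mul]

/-- If x² ∈ 2O, then (zx)² ∈ 2O and hence tr(zx) is even for every z. So x lies in the radical of
the trace form modulo 2, and since x ∉ 2O the Gram matrix is singular modulo 2. -/
lemma even_discr_of_hasSqZeroModTwo (h : HasSqZeroModTwo O) : (2 : ℤ) ∣ Algebra.discr ℤ b := by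
  obtain ⟨x, hx, hxx⟩ := h
  have htr : ∀ z, (2 : ℤ) ∣ Algebra.trace ℤ O (z * x) := fun z => by
    apply two_dvd_trace_of_two_dvd_trace_mul_self b
    apply two_dvd_trace_of_two_dvd
    have : z * x * (z * x) = x * x * (z * z) := by ring
    rw [this]
    exact hxx.mul_right _
  have h0 := htr (b 0)
  have h1 := htr (b 1)
  rw [trace_mul_eq b] at h0 h1
  rw [mul_comm (b 1) (b 0)] at h1
  rw [two_dvd_iff_repr b, not_and_or] at hx
  rw [discr_fin_two]
  set T00 := Algebra.trace ℤ O (b 0 * b 0)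
  set T01 := Algebra.trace ℤ O (b 0 * b 1)
  set T11 := Algebra.trace ℤ O (b 1 * b 1)
  -- Cramer's rule: the discriminant times either coordinate of x is even, and one of the
  -- coordinates is odd.
  rcases hx with hx | hx
  · refine (Int.prime_two.dvd_or_dvd (a := b.repr x 0) ?_).resolve_left hx
    have := dvd_sub (h0.mul_left T11) (h1.mul_left T01)
    convert this using 1
    ring
  · refine (Int.prime_two.dvd_or_dvd (a := b.repr x 1) ?_).resolve_left hx
    have := dvd_sub (h1.mul_left T00) (h0.mul_left T01)
    convert this using 1
    ring

-- With even trace, Cayley–Hamilton gives z² ≡ N modulo 2. So z or z + 1 has square zero modulo 2,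
-- according to the parity of N; neither is in 2O, because z ∉ ℤ + 2O.
include b in
lemma hasSqZeroModTwo_of_trace {z : O} (hz : ∀ (m : ℤ) (w : O), z ≠ m • (1 : O) + 2 * w)
    (ht : (2 : ℤ) ∣ Algebra.trace ℤ O z) : HasSqZeroModTwo O := by
  obtain ⟨N, hN⟩ := exists_mul_self_eq b z
  obtain ⟨t, ht⟩ := ht
  rw [ht] at hN
  rcases Int.even_or_odd' N with ⟨k, rfl | rfl⟩
  · refine ⟨z, ?_, t • z - k • (1 : O), ?_⟩
    · rintro ⟨w, hw⟩
      exact hz 0 w (by simpa using hw)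
    · rw [hN]
      simp only [zsmul_eq_mul]
      push_cast
      ring
  · refine ⟨z + 1, ?_, t • z - k • (1 : O) + z, ?_⟩
    · rintro ⟨w, hw⟩
      exact hz (-1) w (by rw [← hw]; simp)
    · have : (z + 1) * (z + 1) = z * z + 2 * z + 1 := by ring
      rw [this, hN]
      simp only [zsmul_eq_mul]
      push_cast
      ring

-- O/2O is a plane over 𝔽₂, and the multiples of 1 fill at most a line in it.
include b in
lemma exists_ne_zsmul_one_add : ∃ z : O, ∀ (m : ℤ) (w : O), z ≠ m • (1 : O) + 2 * w := by
  have key : ∀ (z : O) (m : ℤ) (w : O), z = m • (1 : O) + 2 * w → ∀ i,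
      b.repr z i = m * b.repr 1 i + 2 * b.repr w i := by
    intro z m w h i
    have h2 : 2 * w = (2 : ℤ) • w := by simp
    rw [h, h2, map_add, map_zsmul, map_zsmul]
    simp [-zsmul_eq_mul]
  by_contra! hcon
  obtain ⟨m, w, h⟩ := hcon (b 0)
  obtain ⟨m', w', h'⟩ := hcon (b 1)
  have a0 := key _ _ _ h 0
  have a1 := key _ _ _ h 1
  have c0 := key _ _ _ h' 0
  have c1 := key _ _ _ h' 1
  simp at a0 a1 c0 c1
  have e0 : ¬ (2 : ℤ) ∣ m * b.repr 1 0 := by omega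
  have e1 : (2 : ℤ) ∣ m * b.repr 1 1 := by omega
  have e2 : ¬ (2 : ℤ) ∣ m' * b.repr 1 1 := by omega
  rcases Int.prime_two.dvd_or_dvd e1 with h | h
  · exact e0 (h.mul_right _)
  · exact e2 (h.mul_left _)

/-- A singular Gram matrix gives x ∉ 2O in the radical of the trace form modulo 2. If x ∉ ℤ + 2O,
then x itself has even trace and `hasSqZeroModTwo_of_trace` applies. Otherwise x is congruent to an
odd integer, so every trace is even and any z ∉ ℤ + 2O will do. -/
lemma hasSqZeroModTwo_of_even_discr (h : (2 : ℤ) ∣ Algebra.discr ℤ b) : HasSqZeroModTwo O := by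
  obtain ⟨x, hx, htr⟩ : ∃ x : O, ¬ (2 : O) ∣ x ∧ ∀ z, (2 : ℤ) ∣ Algebra.trace ℤ O (x * z) := by
    rw [discr_fin_two] at h
    by_cases hc : (2 : ℤ) ∣ Algebra.trace ℤ O (b 0 * b 1) ∧ (2 : ℤ) ∣ Algebra.trace ℤ O (b 1 * b 1)
    · refine ⟨b 1, ?_, fun z => ?_⟩
      · rw [two_dvd_iff_repr b]
        simp
      · rw [trace_mul_eq b, mul_comm (b 1) (b 0)]
        exact dvd_add (hc.1.mul_left _) (hc.2.mul_left _)
    -- Coefficients from the adjugate of the Gram matrix: this vector pairs to the discriminant with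
    -- `b 0` and to 0 with `b 1`.
    · refine ⟨Algebra.trace ℤ O (b 1 * b 1) • b 0 - Algebra.trace ℤ O (b 0 * b 1) • b 1, ?_,
        fun z => ?_⟩
      · rw [two_dvd_iff_repr b]
        rintro ⟨h0, h1⟩
        refine hc ⟨?_, ?_⟩
        · simpa [-zsmul_eq_mul] using h1
        · simpa [-zsmul_eq_mul] using h0
      · rw [trace_mul_eq b]
        simp only [sub_mul, smul_mul_assoc, map_sub, map_zsmul, smul_eq_mul, mul_comm (b 1) (b 0)]
        refine dvd_add (Dvd.dvd.mul_left ?_ _) (Dvd.dvd.mul_left ?_ _)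
        · rwa [mul_comm (Algebra.trace ℤ O (b 1 * b 1))]
        · rw [mul_comm, sub_self]
          exact dvd_zero _
  by_cases hx1 : ∀ (m : ℤ) (w : O), x ≠ m • (1 : O) + 2 * w
  · exact hasSqZeroModTwo_of_trace b hx1 (by simpa using htr 1)
  · push Not at hx1
    obtain ⟨m, w, rfl⟩ := hx1
    have hm : ¬ (2 : ℤ) ∣ m := by
      rintro ⟨k, rfl⟩
      exact hx ⟨k • 1 + w, by simp only [zsmul_eq_mul]; push_cast; ring⟩
    obtain ⟨z, hz⟩ := exists_ne_zsmul_one_add b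
    refine hasSqZeroModTwo_of_trace b hz ?_
    have h1 := htr z
    have h2 : (m • (1 : O) + 2 * w) * z = m • z + 2 * (w * z) := by
      simp only [zsmul_eq_mul]
      ring
    rw [h2, map_add, map_zsmul] at h1
    have h3 := (Int.dvd_add_left (two_dvd_trace_of_two_dvd (Dvd.intro _ rfl))).mp h1
    exact (Int.prime_two.dvd_or_dvd h3).resolve_left hm

end RankTwo

/-! ### Orders in number fields: bases and discriminants over ℤ and over ℚ -/

section Order

variable {K : Type} [Field K] [NumberField K] {O : Subring K}

/-- Since O spans K over ℚ, clearing denominators moves any element of K into O. Thus K is O with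
the nonzero integers inverted, and bases and trace forms of O extend to K. -/
lemma IsOrder.isLocalization (hO : IsOrder O) :
    IsLocalization (Algebra.algebraMapSubmonoid O (nonZeroDivisors ℤ)) K := by
  have hne : ∀ m : ℤ, m ≠ 0 → (m : K) ≠ 0 := fun m hm => by exact_mod_cast hm
  refine ⟨⟨?_, ?_, ?_⟩⟩
  · rintro ⟨_, m, hm, rfl⟩
    have := hne m (nonZeroDivisors.ne_zero hm)
    simpa using this
  · intro z
    have hz : z ∈ Submodule.span ℚ (O : Set K) := hO.2 ▸ Submodule.mem_top
    suffices h : ∃ m : ℤ, m ≠ 0 ∧ z * m ∈ O by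
      obtain ⟨m, hm, h⟩ := h
      refine ⟨(⟨_, h⟩, ⟨_, m, mem_nonZeroDivisors_of_ne_zero hm, rfl⟩), ?_⟩
      change z * m = z * algebraMap O K (m : O)
      simp
    induction hz using Submodule.span_induction with
    | mem x hx => exact ⟨1, one_ne_zero, by simpa using hx⟩
    | zero => exact ⟨1, one_ne_zero, by simp [O.zero_mem]⟩
    | add x y _ _ hx hy =>
      obtain ⟨m, hm, hx⟩ := hx
      obtain ⟨k, hk, hy⟩ := hy
      refine ⟨m * k, mul_ne_zero hm hk, ?_⟩
      have h := O.add_mem (O.mul_mem hx (intCast_mem O k)) (O.mul_mem hy (intCast_mem O m))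
      convert h using 1
      push_cast
      ring
    | smul q x _ hx =>
      obtain ⟨m, hm, hx⟩ := hx
      refine ⟨m * q.den, mul_ne_zero hm (by exact_mod_cast q.den_ne_zero), ?_⟩
      have h := O.mul_mem hx (intCast_mem O q.num)
      convert h using 1
      have hq : (q : K) * (q.den : K) = q.num := by
        exact_mod_cast congrArg (Rat.cast : ℚ → K) (Rat.mul_den_eq_num q)
      rw [Rat.smul_def]
      push_cast
      linear_combination x * m * hq
  · intro x y h
    exact ⟨1, by simpa using Subtype.ext h⟩

lemma IsOrder.discr_eq {ι : Type*} [Fintype ι] [DecidableEq ι] (hO : IsOrder O)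
    (b : Module.Basis ι ℤ O) :
    Algebra.discr ℚ (fun i => (b i : K)) = (Algebra.discr ℤ b : ℤ) := by
  have := hO.isLocalization
  have := hO.1
  have : Module.Free ℤ O := .of_basis b
  have h := Algebra.discr_localizationLocalization ℤ (nonZeroDivisors ℤ) (Rₘ := ℚ) K b
  simp only [eq_intCast] at h
  rw [← h]
  congr 1
  funext i
  rw [Module.Basis.localizationLocalization_apply]
  rfl

lemma IsOrder.exists_basis (hK : Module.finrank ℚ K = 2) (hO : IsOrder O) :
    Nonempty (Module.Basis (Fin 2) ℤ O) := by
  have := hO.isLocalization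
  have := hO.1
  have : Module.IsTorsionFree ℤ O := inferInstance
  have : Module.Free ℤ O := Module.free_of_finite_type_torsion_free'
  let b := Module.Free.chooseBasis ℤ O
  have h := Module.finrank_eq_card_basis (b.localizationLocalization ℚ (nonZeroDivisors ℤ) K)
  rw [hK] at h
  exact ⟨b.reindex (Fintype.equivFinOfCardEq h.symm)⟩

/-- The right-hand side mentions neither the basis nor K, so parity is an invariant of the ring O up
to isomorphism. -/
lemma HasDiscr.two_dvd_iff (hO : IsOrder O) {d : ℤ} (hd : HasDiscr O d) :
    (2 : ℤ) ∣ d ↔ HasSqZeroModTwo O := by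
  obtain ⟨b, hb⟩ := hd
  rw [hO.discr_eq] at hb
  have hb : Algebra.discr ℤ b = d := by exact_mod_cast hb
  rw [← hb]
  exact ⟨hasSqZeroModTwo_of_even_discr b, even_discr_of_hasSqZeroModTwo b⟩

end Order

/-! ### Parity of a CM curve in terms of its endomorphism ring -/

section Parity

variable (E : WeierstrassCurve ℂ) [E.IsElliptic]

lemma isEven_iff (h : HasCM E) : IsEven E ↔ HasSqZeroModTwo (End E) := by
  constructor
  · rintro ⟨K, _, _, O, hK, hO, ⟨e⟩, d, hd, hev⟩
    exact ((hd.two_dvd_iff hO).mp hev.two_dvd).of_ringEquiv e.symm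
  · intro hs
    obtain ⟨K, _, _, O, hK, hO, ⟨e⟩⟩ := h
    obtain ⟨b⟩ := hO.exists_basis hK.1
    have hd : HasDiscr O (Algebra.discr ℤ b) := ⟨b, hO.discr_eq b⟩
    exact ⟨K, _, _, O, hK, hO, ⟨e⟩, _, hd,
      even_iff_two_dvd.mpr ((hd.two_dvd_iff hO).mpr (hs.of_ringEquiv e))⟩

lemma isOdd_iff (h : HasCM E) : IsOdd E ↔ ¬ HasSqZeroModTwo (End E) := by
  constructor
  · rintro ⟨K, _, _, O, hK, hO, ⟨e⟩, d, hd, hodd⟩ hs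
    have := even_iff_two_dvd.mpr ((hd.two_dvd_iff hO).mpr (hs.of_ringEquiv e))
    exact Int.not_even_iff_odd.mpr hodd this
  · intro hs
    obtain ⟨K, _, _, O, hK, hO, ⟨e⟩⟩ := h
    obtain ⟨b⟩ := hO.exists_basis hK.1
    have hd : HasDiscr O (Algebra.discr ℤ b) := ⟨b, hO.discr_eq b⟩
    refine ⟨K, _, _, O, hK, hO, ⟨e⟩, _, hd, Int.not_even_iff_odd.mp fun hev => hs ?_⟩
    exact ((hd.two_dvd_iff hO).mp hev.two_dvd).of_ringEquiv e.symm

end Parity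

open MvPolynomial WeierstrassCurve
open scoped WeierstrassCurve.Projective

/-! ### Polynomial implications over `ℂ` and descent of algebraic functions -/

/-- An implication between polynomial equations that holds over `ℂ` holds over every field
extension of `ℂ`. -/
lemma aeval_eq_zero_of_forall_complex {σ : Type*} [Finite σ] {S : Set (MvPolynomial σ ℂ)}
    {q : MvPolynomial σ ℂ} (h : ∀ x : σ → ℂ, (∀ p ∈ S, eval x p = 0) → eval x q = 0)
    {Ω : Type*} [Field Ω] [Algebra ℂ Ω] {x : σ → Ω} (hx : ∀ p ∈ S, aeval x p = 0) :
    aeval x q = 0 := by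
  -- Nullstellensatz: a power of q lies in the ideal generated by S, and this persists over any
  -- extension field.
  have hq : q ∈ (Ideal.span S).radical := by
    rw [← vanishingIdeal_zeroLocus_eq_radical (K := ℂ)]
    intro y hy
    simpa using h y fun p hp => by simpa using hy p (Ideal.subset_span hp)
  obtain ⟨n, hn⟩ := hq
  have hle : Ideal.span S ≤ RingHom.ker (aeval (R := ℂ) x) := Ideal.span_le.mpr hx
  have h0 : aeval x (q ^ n) = 0 := hle hn
  rw [map_pow] at h0
  exact eq_zero_of_pow_eq_zero h0

/-- Let `c` be a point of the plane curve `W = 0` with coordinates in a field `L`. If the value of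
the rational function `H / G` at complex points of the curve depends only on the values of the
rational functions `A i / D`, then `H / G` is at `c` a rational function of the `A i / D`. -/
lemma exists_aeval_mul_eq_of_forall {σ ι : Type*} [Finite σ] {L : Type*} [Field L] [Algebra ℂ L]
    (W D G H : MvPolynomial σ ℂ) (A : ι → MvPolynomial σ ℂ) (c : σ → L)
    (hW : aeval c W = 0) (hD : aeval c D ≠ 0) (hG : aeval c G ≠ 0)
    (halg : Algebra.IsAlgebraic
      (IntermediateField.adjoin ℂ (Set.range fun i => aeval c (A i) / aeval c D)) L)
    (h : ∀ s t : σ → ℂ, eval s W = 0 → eval t W = 0 → eval s D ≠ 0 → eval t D ≠ 0 →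
      eval s G ≠ 0 → eval t G ≠ 0 → (∀ i, eval s (A i) * eval t D = eval t (A i) * eval s D) →
      eval s H * eval t G = eval t H * eval s G) :
    ∃ p q : MvPolynomial ι ℂ, aeval (fun i => aeval c (A i) / aeval c D) q ≠ 0 ∧
      aeval c H / aeval c G * aeval (fun i => aeval c (A i) / aeval c D) q =
        aeval (fun i => aeval c (A i) / aeval c D) p := by
  set w : ι → L := fun i => aeval c (A i) / aeval c D with hw
  set K := IntermediateField.adjoin ℂ (Set.range w) with hK
  -- In characteristic zero the algebraic closure Ω of L is Galois over K, so it suffices that every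
  -- τ fixes H / G.
  have hmem : aeval c H / aeval c G ∈ K := by
    let Ω := AlgebraicClosure L
    have : Algebra.IsAlgebraic K Ω := Algebra.IsAlgebraic.trans K L Ω
    have : IsAlgClosure K Ω := ⟨inferInstance, inferInstance⟩
    have : IsGalois K Ω := IsAlgClosure.isGalois K Ω
    have key : ∀ τ : Gal(Ω/K),
        τ (algebraMap L Ω (aeval c H / aeval c G)) = algebraMap L Ω (aeval c H / aeval c G) := by
      intro τ
      let ρ : Ω →ₐ[ℂ] Ω := (τ.toAlgHom).restrictScalars ℂ
      have hρ : ∀ z, ρ z = τ z := fun _ => rfl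
      let a : σ → Ω := fun i => algebraMap L Ω (c i)
      let a' : σ → Ω := fun i => τ (a i)
      have ha : ∀ F : MvPolynomial σ ℂ, aeval a F = algebraMap L Ω (aeval c F) := fun F =>
        aeval_algebraMap_apply Ω c F
      have ha' : ∀ F : MvPolynomial σ ℂ, aeval a' F = τ (algebraMap L Ω (aeval c F)) := fun F => by
        rw [← ha, ← hρ]
        exact (comp_aeval_apply (f := a) ρ F).symm
      have hfix : ∀ i, τ (algebraMap L Ω (w i)) = algebraMap L Ω (w i) := fun i => by
        have hi : w i ∈ K := IntermediateField.subset_adjoin _ _ ⟨i, rfl⟩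
        exact τ.commutes ⟨w i, hi⟩
      let l : MvPolynomial σ ℂ → MvPolynomial (σ ⊕ σ) ℂ := rename Sum.inl
      let r : MvPolynomial σ ℂ → MvPolynomial (σ ⊕ σ) ℂ := rename Sum.inr
      -- The pair (c, τc) is a point over Ω of the product of two copies of the curve, with equal
      -- values of the A i / D. The hypothesis is transferred to this point; the factors D and G
      -- absorb its nonvanishing conditions into one polynomial equation.
      have main := aeval_eq_zero_of_forall_complex
        (S := {l W, r W} ∪ Set.range fun i => l (A i) * r D - r (A i) * l D)
        (q := l D * r D * (l G * r G) * (l H * r G - r H * l G)) (Ω := Ω) (x := Sum.elim a a')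
        (by
          intro x hx
          have h1 := hx (l W) (by simp)
          have h2 := hx (r W) (by simp)
          have h3 : ∀ i, eval x (l (A i) * r D - r (A i) * l D) = 0 := fun i => hx _ (by simp)
          simp only [l, r, eval_rename, map_sub, map_mul] at h1 h2 h3 ⊢
          by_contra hne
          simp only [mul_eq_zero, not_or] at hne
          exact hne.2 (sub_eq_zero.mpr (h _ _ h1 h2 hne.1.1.1 hne.1.1.2 hne.1.2.1 hne.1.2.2
            fun i => sub_eq_zero.mp (h3 i))))
        (by
          rintro p ((rfl | rfl) | ⟨i, rfl⟩)
          · simp only [l, aeval_rename, Sum.elim_comp_inl, ha, hW, map_zero]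
          · simp only [r, aeval_rename, Sum.elim_comp_inr, ha', hW, map_zero]
          · simp only [l, r, aeval_rename, Sum.elim_comp_inl, Sum.elim_comp_inr, ha, ha', map_sub,
              map_mul]
            have hA : aeval c (A i) = w i * aeval c D := by
              simp only [hw]
              rw [div_mul_cancel₀ _ hD]
            rw [hA, map_mul, map_mul, hfix]
            ring)
      simp only [l, r, aeval_rename, Sum.elim_comp_inl, Sum.elim_comp_inr, ha, ha', map_sub,
        map_mul] at main
      have hne : ∀ z : L, z ≠ 0 → algebraMap L Ω z ≠ 0 := fun z hz => by simpa using hz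
      have hne' : ∀ z : L, z ≠ 0 → τ (algebraMap L Ω z) ≠ 0 := fun z hz => by simpa using hz
      have h4 := (mul_eq_zero.mp main).resolve_left
        (mul_ne_zero (mul_ne_zero (hne _ hD) (hne' _ hD)) (mul_ne_zero (hne _ hG) (hne' _ hG)))
      rw [map_div₀, map_div₀, div_eq_div_iff (hne' _ hG) (hne _ hG)]
      exact (sub_eq_zero.mp h4).symm
    obtain ⟨z, hz⟩ := (InfiniteGalois.mem_range_algebraMap_iff_fixed _).mpr key
    have hz' : algebraMap L Ω (z : L) = algebraMap L Ω (aeval c H / aeval c G) := hz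
    rw [← (algebraMap L Ω).injective hz']
    exact z.2
  obtain ⟨p, q, hpq⟩ := (IntermediateField.mem_adjoin_range_iff ℂ w _).mp hmem
  -- If the denominator vanishes, the quotient is 0 by the convention on division and is represented
  -- by 0 / 1.
  by_cases hq : aeval w q = 0
  · exact ⟨0, 1, by simp, by rw [hpq, hq]; simp⟩
  · exact ⟨p, q, hq, by rw [hpq, div_mul_cancel₀ _ hq]⟩

/-- In transcendence degree at most one, a single transcendental z is already a transcendence basis,
so L is algebraic over F(z) ⊆ K. -/
lemma isAlgebraic_of_transcendental {F L : Type*} [Field F] [Field L] [Algebra F L]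
    (htr : Algebra.trdeg F L ≤ 1) {K : IntermediateField F L} {z : L} (hz : z ∈ K)
    (ht : Transcendental F z) : Algebra.IsAlgebraic K L := by
  have hi : AlgebraicIndependent F fun _ : Unit => z :=
    (algebraicIndependent_unique_type_iff).mpr ht
  have hb := hi.isTranscendenceBasis_of_lift_trdeg_le_of_finite (by simpa using htr)
  have h := hb.isAlgebraic_field
  have hle : IntermediateField.adjoin F (Set.range fun _ : Unit => z) ≤ K :=
    IntermediateField.adjoin_le_iff.mpr (by rintro _ ⟨_, rfl⟩; exact hz)
  let _ := (IntermediateField.inclusion hle).toAlgebra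
  have : IsScalarTower (IntermediateField.adjoin F (Set.range fun _ : Unit => z)) K L :=
    .of_algebraMap_eq fun _ => rfl
  exact Algebra.IsAlgebraic.tower_top
    (K := IntermediateField.adjoin F (Set.range fun _ : Unit => z)) K

/-- Homogenization of polynomials in two variables. -/
lemma exists_isHomogeneous_eval (p : MvPolynomial (Fin 2) ℂ) :
    ∃ n₀, ∀ n ≥ n₀, ∃ P : MvPolynomial (Fin 3) ℂ, P.IsHomogeneous n ∧
      ∀ a b, eval ![a, b, 1] P = eval ![a, b] p := by
  induction p using MvPolynomial.induction_on with
  | C c =>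
    exact ⟨0, fun n _ => ⟨C c * X 2 ^ n,
      (by simpa using (isHomogeneous_X_pow (R := ℂ) 2 n).C_mul c),
      fun a b => by simp⟩⟩
  | add p q hp hq =>
    obtain ⟨n₀, hp⟩ := hp
    obtain ⟨n₁, hq⟩ := hq
    refine ⟨max n₀ n₁, fun n hn => ?_⟩
    obtain ⟨P, hP, hp⟩ := hp n (le_of_max_le_left hn)
    obtain ⟨Q, hQ, hq⟩ := hq n (le_of_max_le_right hn)
    exact ⟨P + Q, hP.add hQ, fun a b => by simp [hp, hq]⟩
  | mul_X p i hp =>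
    obtain ⟨n₀, hp⟩ := hp
    refine ⟨n₀ + 1, fun n hn => ?_⟩
    obtain ⟨m, rfl⟩ : ∃ m, n = m + 1 := ⟨n - 1, by omega⟩
    obtain ⟨P, hP, hp⟩ := hp m (by omega)
    refine ⟨P * X i.castSucc, hP.mul (isHomogeneous_X _ _), fun a b => ?_⟩
    rw [map_mul, map_mul, hp]
    fin_cases i <;> simp

/-! ### Affine points and the function field -/

section AffinePoints

variable (E : WeierstrassCurve ℂ)

/-- The affine points of `E`. -/
abbrev AffinePt : Type := {s : Fin 2 → ℂ // E.toAffine.Equation (s 0) (s 1)}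

/-- The Weierstrass equation as a polynomial in two variables. -/
def weierstrassPoly : MvPolynomial (Fin 2) ℂ :=
  X 1 ^ 2 + C E.a₁ * X 0 * X 1 + C E.a₃ * X 1 -
    (X 0 ^ 3 + C E.a₂ * X 0 ^ 2 + C E.a₄ * X 0 + C E.a₆)

lemma eval_weierstrassPoly (s : Fin 2 → ℂ) :
    eval s (weierstrassPoly E) = 0 ↔ E.toAffine.Equation (s 0) (s 1) := by
  rw [Affine.equation_iff']
  simp [weierstrassPoly]

/-- The coordinate functions in the coordinate ring. -/
def coordGen : Fin 2 → E.toAffine.CoordinateRing :=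
  ![Affine.CoordinateRing.mk E.toAffine (Polynomial.C Polynomial.X),
    Affine.CoordinateRing.mk E.toAffine Polynomial.X]

lemma aeval_coordGen_weierstrassPoly : aeval (coordGen E) (weierstrassPoly E) = 0 := by
  have h : Affine.CoordinateRing.mk E.toAffine E.toAffine.polynomial = 0 := AdjoinRoot.mk_self
  rw [← h]
  have hC : ∀ c : ℂ, algebraMap ℂ E.toAffine.CoordinateRing c =
    Affine.CoordinateRing.mk E.toAffine (Polynomial.C (Polynomial.C c)) := fun c => rfl
  simp only [weierstrassPoly, coordGen, Affine.polynomial, map_add, map_sub, map_mul, map_pow,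
    aeval_X, aeval_C, hC, Matrix.cons_val_zero, Matrix.cons_val_one]
  ring

variable {E} in
lemma AffinePt.eval₂_polynomial (s : AffinePt E) :
    Polynomial.eval₂ (Polynomial.evalRingHom (s.1 0)) (s.1 1) E.toAffine.polynomial = 0 := by
  rw [Polynomial.eval₂_evalRingHom]
  exact s.2

/-- Evaluation of regular functions at an affine point. -/
def evalAt (s : AffinePt E) : E.toAffine.CoordinateRing →ₐ[ℂ] ℂ where
  toRingHom := AdjoinRoot.lift (Polynomial.evalRingHom (s.1 0)) (s.1 1) s.eval₂_polynomial
  commutes' c := by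
    have hC : algebraMap ℂ E.toAffine.CoordinateRing c =
      AdjoinRoot.of E.toAffine.polynomial (Polynomial.C c) := rfl
    rw [hC]
    simp

lemma evalAt_mk (s : AffinePt E) (q : Polynomial (Polynomial ℂ)) :
    evalAt E s (Affine.CoordinateRing.mk E.toAffine q) = 
      (q.eval (Polynomial.C (s.1 1))).eval (s.1 0) :=
  (AdjoinRoot.lift_mk s.eval₂_polynomial q).trans (by rw [Polynomial.eval₂_evalRingHom])

lemma evalAt_aeval (s : AffinePt E) (F : MvPolynomial (Fin 2) ℂ) :
    evalAt E s (aeval (coordGen E) F) = eval s.1 F := by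
  rw [comp_aeval_apply, ← coe_aeval_eq_eval]
  change _ = aeval s.1 F
  congr 2
  funext i
  fin_cases i
  · exact (evalAt_mk E s _).trans (by simp)
  · exact (evalAt_mk E s _).trans (by simp)

lemma finite_setOf_fst_eq (a : ℂ) : {s : AffinePt E | s.1 0 = a}.Finite := by
  let p : Polynomial ℂ := Polynomial.C 1 * Polynomial.X ^ 2 +
    Polynomial.C (E.a₁ * a + E.a₃) * Polynomial.X +
        Polynomial.C (-(a ^ 3 + E.a₂ * a ^ 2 + E.a₄ * a + E.a₆))
  have hp : p ≠ 0 := by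
    intro h
    have := Polynomial.degree_quadratic (b := E.a₁ * a + E.a₃)
      (c := -(a ^ 3 + E.a₂ * a ^ 2 + E.a₄ * a + E.a₆)) (one_ne_zero (α := ℂ))
    change p.degree = 2 at this
    rw [h] at this
    simp at this
  refine Set.Finite.of_finite_image ((p.rootSet_finite ℂ).subset
    (?_ : (fun s => s.1 1) '' _ ⊆ _)) ?_
  · rintro _ ⟨s, hs, rfl⟩
    have h := (Affine.equation_iff' _ _).mp s.2
    rw [Set.mem_ofPred_eq.mp hs] at h
    rw [Polynomial.mem_rootSet]
    refine ⟨hp, ?_⟩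
    simp only [p, map_add, map_mul, Polynomial.aeval_C, Polynomial.aeval_X, map_pow,
      Algebra.algebraMap_self, RingHom.id_apply]
    linear_combination h
  · intro s hs t ht hst
    apply Subtype.ext
    funext i
    fin_cases i
    · exact (Set.mem_ofPred_eq.mp hs).trans (Set.mem_ofPred_eq.mp ht).symm
    · exact hst

lemma fst_surjective : Function.Surjective fun s : AffinePt E => s.1 0 := by
  intro a
  obtain ⟨b, hb⟩ := IsAlgClosed.exists_root
    (Polynomial.C 1 * Polynomial.X ^ 2 + Polynomial.C (E.a₁ * a + E.a₃) * Polynomial.X +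
      Polynomial.C (-(a ^ 3 + E.a₂ * a ^ 2 + E.a₄ * a + E.a₆)))
    (by rw [Polynomial.degree_quadratic one_ne_zero]; norm_num)
  refine ⟨⟨![a, b], (Affine.equation_iff _ _).mpr ?_⟩, rfl⟩
  simp only [Polynomial.IsRoot, Polynomial.eval_add, Polynomial.eval_mul, Polynomial.eval_C,
    Polynomial.eval_pow, Polynomial.eval_X] at hb
  simp only [Matrix.cons_val_zero, Matrix.cons_val_one]
  linear_combination hb

instance : Infinite (AffinePt E) := Infinite.of_surjective _ (fst_surjective E)

/-- As r is integral over ℂ[X], some nonzero polynomial in X is a multiple of r. The zeros of r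
therefore lie over finitely many abscissas, each carrying finitely many points. -/
lemma finite_setOf_evalAt_eq_zero {r : E.toAffine.CoordinateRing} (hr : r ≠ 0) :
    {s | evalAt E s r = 0}.Finite := by
  have : Module.Finite (Polynomial ℂ) E.toAffine.CoordinateRing :=
    .of_basis (Affine.CoordinateRing.basis E.toAffine)
  have hne := Ideal.comap_ne_bot_of_integral_mem (R := Polynomial ℂ) (I := Ideal.span {r}) hr
    (Ideal.mem_span_singleton_self r) (Algebra.IsIntegral.isIntegral r)
  obtain ⟨p, hp, hp0⟩ := Submodule.exists_mem_ne_zero_of_ne_bot hne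
  obtain ⟨k, hk⟩ := Ideal.mem_span_singleton.mp (Ideal.mem_comap.mp hp)
  refine ((p.rootSet_finite ℂ).biUnion fun a _ => finite_setOf_fst_eq E a).subset ?_
  intro s hs
  simp only [Set.mem_iUnion, Set.mem_ofPred_eq, exists_prop]
  refine ⟨_, Polynomial.mem_rootSet.mpr ⟨hp0, ?_⟩, rfl⟩
  have h := congrArg (evalAt E s) hk
  rw [map_mul, Set.mem_ofPred_eq.mp hs, zero_mul] at h
  rw [← h]
  exact ((evalAt_mk E s (Polynomial.C p)).trans (by simp)).symm

/-- Germs of complex functions on `E` up to finitely many points. -/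
abbrev CofiniteGerm : Type := (Filter.cofinite : Filter (AffinePt E)).Germ ℂ

/-- Regular functions as germs. -/
def coordToGerm : E.toAffine.CoordinateRing →+* CofiniteGerm E :=
  (Filter.Germ.coeRingHom _).comp (RingHom.pi fun s => (evalAt E s : _ →+* ℂ))

lemma coordToGerm_apply (r : E.toAffine.CoordinateRing) :
    coordToGerm E r = ((fun s => evalAt E s r : AffinePt E → ℂ) : CofiniteGerm E) := rfl

/-- Rational functions as germs. -/
def toGerm : E.toAffine.FunctionField →+* CofiniteGerm E :=
  IsLocalization.lift (M := nonZeroDivisors E.toAffine.CoordinateRing) (g := coordToGerm E) (by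
    rintro ⟨r, hr⟩
    rw [coordToGerm_apply]
    refine IsUnit.of_mul_eq_one
      ((fun s => (evalAt E s r)⁻¹ : AffinePt E → ℂ) : CofiniteGerm E) ?_
    refine Filter.Germ.coe_eq.mpr ?_
    have h := finite_setOf_evalAt_eq_zero E (nonZeroDivisors.ne_zero hr)
    filter_upwards [h.compl_mem_cofinite] with s hs
    exact mul_inv_cancel₀ hs)

/-- The generic point of `E`. -/
def genericPt : Fin 2 → E.toAffine.FunctionField := fun i => algebraMap _ _ (coordGen E i)

lemma aeval_genericPt (F : MvPolynomial (Fin 2) ℂ) :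
    aeval (genericPt E) F = algebraMap _ E.toAffine.FunctionField (aeval (coordGen E) F) :=
  aeval_algebraMap_apply _ _ _

lemma toGerm_aeval_genericPt (F : MvPolynomial (Fin 2) ℂ) :
    toGerm E (aeval (genericPt E) F) =
      ((fun s => eval s.1 F : AffinePt E → ℂ) : CofiniteGerm E) := by
  rw [aeval_genericPt, toGerm, IsLocalization.lift_eq, coordToGerm_apply]
  simp only [evalAt_aeval]

lemma eventually_ne_zero {F : MvPolynomial (Fin 2) ℂ} (hF : aeval (genericPt E) F ≠ 0) :
    ∀ᶠ s : AffinePt E in Filter.cofinite, eval s.1 F ≠ 0 := by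
  have h : aeval (coordGen E) F ≠ 0 := fun h => hF (by rw [aeval_genericPt, h, map_zero])
  filter_upwards [(finite_setOf_evalAt_eq_zero E h).compl_mem_cofinite] with s hs
  rwa [← evalAt_aeval]

lemma eval_eq_zero_of_aeval_genericPt {F : MvPolynomial (Fin 2) ℂ}
    (hF : aeval (genericPt E) F = 0) (s : AffinePt E) : eval s.1 F = 0 := by
  rw [aeval_genericPt] at hF
  have h : aeval (coordGen E) F = 0 := IsFractionRing.injective _ E.toAffine.FunctionField
    (by rw [hF, map_zero])
  rw [← evalAt_aeval, h, map_zero]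

lemma toGerm_algebraMap (c : ℂ) :
    toGerm E (algebraMap ℂ _ c) = ((fun _ => c : AffinePt E → ℂ) : CofiniteGerm E) := by
  have h := toGerm_aeval_genericPt E (C c)
  simpa using h

lemma toGerm_div {A D : MvPolynomial (Fin 2) ℂ} (hD : aeval (genericPt E) D ≠ 0) :
    toGerm E (aeval (genericPt E) A / aeval (genericPt E) D) =
      ((fun s => eval s.1 A / eval s.1 D : AffinePt E → ℂ) : CofiniteGerm E) := by
  have h : toGerm E (aeval (genericPt E) A / aeval (genericPt E) D) *
      toGerm E (aeval (genericPt E) D) = toGerm E (aeval (genericPt E) A) := by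
    rw [← map_mul, div_mul_cancel₀ _ hD]
  induction hz : toGerm E (aeval (genericPt E) A / aeval (genericPt E) D) using
    Filter.Germ.inductionOn with
  | _ f =>
  rw [hz, toGerm_aeval_genericPt, toGerm_aeval_genericPt] at h
  refine Filter.Germ.coe_eq.mpr ?_
  filter_upwards [Filter.Germ.coe_eq.mp h, eventually_ne_zero E hD] with s hs hs0
  rw [eq_div_iff hs0]
  exact hs

lemma toGerm_aeval {ι : Type*} {w : ι → E.toAffine.FunctionField} {f : ι → AffinePt E → ℂ}
    (hw : ∀ i, toGerm E (w i) = (f i : CofiniteGerm E)) (p : MvPolynomial ι ℂ) :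
    toGerm E (aeval w p) = ((fun s => eval (fun i => f i s) p : AffinePt E → ℂ) :
      CofiniteGerm E) := by
  induction p using MvPolynomial.induction_on with
  | C c => simpa using toGerm_algebraMap E c
  | add p q hp hq =>
    rw [map_add, map_add, hp, hq]
    simp only [map_add]
    rfl
  | mul_X p i hp =>
    rw [map_mul, map_mul, hp, aeval_X, hw]
    simp only [map_mul, eval_X]
    rfl

/-- The germ of z is a unit, with inverse the germ of z⁻¹. -/
lemma eventually_ne_zero_of_toGerm {z : E.toAffine.FunctionField} (hz : z ≠ 0)
    {f : AffinePt E → ℂ} (hf : toGerm E z = (f : CofiniteGerm E)) :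
    ∀ᶠ s in Filter.cofinite, f s ≠ 0 := by
  have h : toGerm E z * toGerm E z⁻¹ = 1 := by
    rw [← map_mul, mul_inv_cancel₀ hz, map_one]
  induction hg : toGerm E z⁻¹ using Filter.Germ.inductionOn with
  | _ g =>
  rw [hf, hg] at h
  filter_upwards [Filter.Germ.coe_eq.mp (h : ((f * g : AffinePt E → ℂ) : CofiniteGerm E) =
    ((1 : AffinePt E → ℂ) : CofiniteGerm E))] with s hs h0
  simp [h0] at hs

lemma trdeg_functionField_le : Algebra.trdeg ℂ E.toAffine.FunctionField ≤ 1 := by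
  have : Module.Finite (Polynomial ℂ) E.toAffine.CoordinateRing :=
    .of_basis (Affine.CoordinateRing.basis E.toAffine)
  have : Algebra.IsAlgebraic (Polynomial ℂ) E.toAffine.CoordinateRing := inferInstance
  have h1 := trdeg_add_eq ℂ (Polynomial ℂ) (A := E.toAffine.CoordinateRing)
  have h2 := trdeg_add_eq ℂ E.toAffine.CoordinateRing (A := E.toAffine.FunctionField)
  have : Algebra.IsAlgebraic E.toAffine.CoordinateRing E.toAffine.FunctionField :=
    IsLocalization.isAlgebraic _ (nonZeroDivisors E.toAffine.CoordinateRing)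
  rw [trdeg_eq_zero (R := Polynomial ℂ), add_zero] at h1
  rw [trdeg_eq_zero (R := E.toAffine.CoordinateRing), add_zero] at h2
  rw [← h2, ← h1, Polynomial.trdeg_of_isDomain]

end AffinePoints

/-! ### Homomorphisms of elliptic curves in affine coordinates -/

section Points

variable {E : WeierstrassCurve ℂ}

lemma IsCoord.eq_zero {p : Fin 3 → ℂ} {P : Pt E} (h : IsCoord p P) (hz : p 2 = 0) : P = 0 := by
  have h0 : IsCoord ![0, 1, 0] (0 : Pt E) := by
    rw [IsCoord, Projective.Point.zero_point]
  exact (h.equiv_iff h0).mp (Projective.equiv_zero_of_Z_eq_zero h.nonsingular hz)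

lemma IsCoord.ne_zero {p : Fin 3 → ℂ} {P : Pt E} (h : IsCoord p P) (hz : p 2 ≠ 0) : P ≠ 0 := by
  rintro rfl
  have h0 : IsCoord ![0, 1, 0] (0 : Pt E) := by
    rw [IsCoord, Projective.Point.zero_point]
  exact Projective.not_equiv_of_Z_eq_zero_right (Q := ![0, 1, 0]) hz rfl
    ((h.equiv_iff h0).mpr rfl)

lemma IsCoord.of_equiv {p q : Fin 3 → ℂ} {P : Pt E} (h : IsCoord p P) (hpq : q ≈ p) :
    IsCoord q P := by
  unfold IsCoord at h ⊢
  rw [← h]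
  exact Quotient.sound hpq

lemma IsCoord.of_mul_eq {p q : Fin 3 → ℂ} {P : Pt E} (h : IsCoord p P) (hp : p 2 ≠ 0)
    (hq : q 2 ≠ 0) (h0 : q 0 * p 2 = p 0 * q 2) (h1 : q 1 * p 2 = p 1 * q 2) : IsCoord q P :=
  h.of_equiv (Projective.equiv_of_X_eq_of_Y_eq hq hp h0 h1)

/-- Projective coordinates of an affine point. -/
def projCoord (s : Fin 2 → ℂ) : Fin 3 → ℂ := ![s 0, s 1, 1]

variable [E.IsElliptic]

/-- The affine points as points of the projective curve. -/
def AffinePt.toPt (s : AffinePt E) : Pt E :=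
  ⟨(Projective.nonsingularLift_some _ _).mpr (Affine.equation_iff_nonsingular.mp s.2)⟩

lemma AffinePt.isCoord (s : AffinePt E) : IsCoord (projCoord s.1) s.toPt := rfl

lemma AffinePt.toPt_ne_zero (s : AffinePt E) : s.toPt ≠ 0 :=
  s.isCoord.ne_zero one_ne_zero

lemma AffinePt.toPt_injective : Function.Injective (AffinePt.toPt (E := E)) := by
  intro s t h
  have h1 := (s.isCoord.equiv_iff t.isCoord).mpr h
  have h2 := (Projective.equiv_iff_eq_of_Z_eq (P := projCoord s.1) (Q := projCoord t.1) rfl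
    one_ne_zero).mp h1
  apply Subtype.ext
  funext i
  fin_cases i
  · exact congrFun h2 0
  · exact congrFun h2 1

instance : Infinite (Pt E) := Infinite.of_injective _ AffinePt.toPt_injective

lemma exists_toPt_eq {P : Pt E} (hP : P ≠ 0) : ∃ s : AffinePt E, s.toPt = P := by
  obtain ⟨p, hp, hn⟩ := exists_isCoord P
  have hz : p 2 ≠ 0 := fun hz => hP (hp.eq_zero hz)
  have hq : IsCoord (projCoord ![p 0 / p 2, p 1 / p 2]) P :=
    hp.of_equiv (Setoid.symm (Projective.equiv_some_of_Z_ne_zero hz))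
  have he := (Projective.nonsingular_some _ _).mp hq.nonsingular
  let s : AffinePt E := ⟨![p 0 / p 2, p 1 / p 2], he.1⟩
  exact ⟨s, (s.isCoord.equiv_iff hq).mp (Setoid.refl _)⟩

lemma exists_smul_projCoord {p : Fin 3 → ℂ} {P : Pt E} (hp : IsCoord p P) (hz : p 2 ≠ 0) :
    ∃ s : AffinePt E, s.toPt = P ∧ p = p 2 • projCoord s.1 := by
  obtain ⟨s, rfl⟩ := exists_toPt_eq (hp.ne_zero hz)
  refine ⟨s, rfl, ?_⟩
  have h := (hp.equiv_iff s.isCoord).mpr rfl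
  have h0 : p 0 * 1 = s.1 0 * p 2 := Projective.X_eq_of_equiv h
  have h1 : p 1 * 1 = s.1 1 * p 2 := Projective.Y_eq_of_equiv h
  funext i
  fin_cases i
  · simpa [projCoord, mul_comm] using h0
  · simpa [projCoord, mul_comm] using h1
  · simp [projCoord]

end Points

/-- A nontrivial coset of H would lie in the finite complement, making H and hence G finite. -/
lemma addSubgroup_eq_top_of_finite_compl {G : Type*} [AddGroup G] [Infinite G] {H : AddSubgroup G}
    (hH : (H : Set G)ᶜ.Finite) : H = ⊤ := by
  by_contra hne
  obtain ⟨a, ha⟩ : ∃ a, a ∉ H := by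
    by_contra! hcon
    exact hne (eq_top_iff.mpr fun x _ => hcon x)
  have h1 : ((fun x => a + x) '' (H : Set G)).Finite := by
    refine hH.subset ?_
    rintro _ ⟨x, hx, rfl⟩ hax
    exact ha ((H.add_mem_cancel_right hx).mp hax)
  have h2 : (H : Set G).Finite := h1.of_finite_image (add_right_injective a).injOn
  exact Set.infinite_univ (by simpa using h2.union hH)

/-! ### Descent of morphisms along a surjective homomorphism with finite kernel -/

section Homomorphisms

lemma eval_smul_of_isHomogeneous {σ R : Type*} [Fintype σ] [CommSemiring R] {p : MvPolynomial σ R}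
    {n : ℕ} (hp : p.IsHomogeneous n) (u : R) (x : σ → R) : eval (u • x) p = u ^ n * eval x p := by
  rw [eval_eq', eval_eq', Finset.mul_sum]
  refine Finset.sum_congr rfl fun d hd => ?_
  have h : ∑ i, d i = n := by
    rw [← Finsupp.degree_eq_sum, Finsupp.degree_eq_weight_one]
    exact hp (mem_support_iff.mp hd)
  simp only [Pi.smul_apply, smul_eq_mul, mul_pow, Finset.prod_mul_distrib,
    Finset.prod_pow_eq_pow_sum, h]
  ring

variable {E₁ E₂ E₃ : WeierstrassCurve ℂ} [E₁.IsElliptic]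

/-- Outside finitely many points, a nonzero homomorphism is given by polynomials in the affine
coordinates. -/
lemma exists_affine_coords {f : Pt E₁ →+ Pt E₂} (hf : IsMorphism f) (hf0 : f ≠ 0) :
    ∃ A : Fin 3 → MvPolynomial (Fin 2) ℂ, aeval (genericPt E₁) (A 2) ≠ 0 ∧
      ∀ s : AffinePt E₁, eval s.1 (A 2) ≠ 0 → IsCoord (fun i => eval s.1 (A i)) (f s.toPt) := by
  obtain ⟨s₀⟩ : Nonempty (AffinePt E₁) := inferInstance
  obtain ⟨d, F, -, hF0, hF⟩ := hf s₀.toPt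
  have he : ∀ s : Fin 2 → ℂ, evalTriple F (projCoord s) =
      fun i => eval s (aeval ![X 0, X 1, 1] (F i)) := by
    intro s
    funext i
    have h1 : eval s (aeval ![X 0, X 1, 1] (F i)) =
        (aeval s : MvPolynomial (Fin 2) ℂ →ₐ[ℂ] ℂ) (aeval ![X 0, X 1, 1] (F i)) := rfl
    rw [h1, comp_aeval_apply]
    change aeval (projCoord s) (F i) = _
    congr 2
    funext j
    fin_cases j <;> simp [projCoord]
  set A : Fin 3 → MvPolynomial (Fin 2) ℂ := fun i => aeval ![X 0, X 1, 1] (F i)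
  have hA : ∀ s : AffinePt E₁, (fun i => eval s.1 (A i)) ≠ 0 →
      IsCoord (fun i => eval s.1 (A i)) (f s.toPt) := by
    intro s hs
    have := hF s.toPt (projCoord s.1) s.isCoord
    rw [he] at this
    exact this hs
  refine ⟨A, fun h2 => hf0 ?_, fun s hs => hA s fun h => hs (congrFun h 2)⟩
  have h0 := hF0 _ s₀.isCoord
  rw [he] at h0
  obtain ⟨i, hi⟩ := Function.ne_iff.mp h0
  have hi' : aeval (genericPt E₁) (A i) ≠ 0 := fun h => hi (eval_eq_zero_of_aeval_genericPt E₁ h s₀)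
  have hfin := Filter.eventually_cofinite.mp (eventually_ne_zero E₁ hi')
  -- If the third coordinate vanished identically, f would be 0 wherever `A i` does not vanish, that
  -- is, outside a finite set; a subgroup with finite complement is everything.
  have hker : f.ker = ⊤ := by
    refine addSubgroup_eq_top_of_finite_compl ((hfin.image AffinePt.toPt).subset ?_)
    intro P hP
    have hP' : f P ≠ 0 := hP
    obtain ⟨s, rfl⟩ := exists_toPt_eq (P := P) (by rintro rfl; simp at hP')
    refine ⟨s, fun hs => hP' ?_, rfl⟩
    exact (hA s fun h => hs (congrFun h i)).eq_zero (eval_eq_zero_of_aeval_genericPt E₁ h2 s)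
  ext P : 1
  exact AddMonoidHom.mem_ker.mp (hker ▸ AddSubgroup.mem_top P)

lemma mem_range_algebraMap_of_isAlgebraic {k L : Type*} [Field k] [IsAlgClosed k] [Field L]
    [Algebra k L] {z : L} (hz : IsAlgebraic k z) : z ∈ Set.range (algebraMap k L) :=
  minpoly.mem_range_of_degree_eq_one k z
    (IsAlgClosed.degree_eq_one_of_irreducible k (minpoly.irreducible hz.isIntegral))

/-- The affine coordinates of a homomorphism with finite fibres are not both constant. -/
lemma exists_transcendental_coord {φ : Pt E₁ →+ Pt E₂} (hker : (φ.ker : Set (Pt E₁)).Finite)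
    {A : Fin 3 → MvPolynomial (Fin 2) ℂ} (hD : aeval (genericPt E₁) (A 2) ≠ 0)
    (hA : ∀ s : AffinePt E₁, eval s.1 (A 2) ≠ 0 →
      IsCoord (fun i => eval s.1 (A i)) (φ s.toPt)) :
    ∃ i : Fin 2, Transcendental ℂ
      (aeval (genericPt E₁) (A i.castSucc) / aeval (genericPt E₁) (A 2)) := by
  by_contra! hcon
  -- Functions algebraic over ℂ are constant, so φ would take one value at almost all points, while
  -- its fibres are cosets of a finite kernel.
  have hc : ∀ i : Fin 2, ∃ c : ℂ, ∀ᶠ s : AffinePt E₁ in Filter.cofinite,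
      eval s.1 (A i.castSucc) / eval s.1 (A 2) = c := by
    intro i
    obtain ⟨c, hc⟩ := mem_range_algebraMap_of_isAlgebraic (not_not.mp (hcon i))
    refine ⟨c, ?_⟩
    have h := toGerm_div E₁ (A := A i.castSucc) hD
    rw [← hc, toGerm_algebraMap] at h
    exact Filter.Germ.coe_eq.mp h.symm
  choose c hc using hc
  have hev := (hc 0).and ((hc 1).and (eventually_ne_zero E₁ hD))
  obtain ⟨s₀, h0, h1, h2⟩ := hev.exists
  have hfin : {P | φ P = φ s₀.toPt}.Finite := by
    refine (hker.image fun x => x + s₀.toPt).subset ?_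
    intro P hP
    exact ⟨P - s₀.toPt, by simpa [AddMonoidHom.mem_ker, sub_eq_zero] using hP, by simp⟩
  have hev2 : ∀ᶠ s : AffinePt E₁ in Filter.cofinite, φ s.toPt = φ s₀.toPt := by
    filter_upwards [hev] with s hs
    obtain ⟨k0, k1, k2⟩ := hs
    refine ((hA s k2).equiv_iff (hA s₀ h2)).mp
      (Projective.equiv_of_X_eq_of_Y_eq k2 h2 ?_ ?_)
    · exact (div_eq_div_iff k2 h2).mp (k0.trans h0.symm)
    · exact (div_eq_div_iff k2 h2).mp (k1.trans h1.symm)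
  have hfin2 : {s : AffinePt E₁ | φ s.toPt = φ s₀.toPt}.Finite :=
    Set.Finite.preimage AffinePt.toPt_injective.injOn hfin
  refine Set.infinite_univ (α := AffinePt E₁) ?_
  have h := hfin2.union (Filter.eventually_cofinite.mp hev2)
  exact h.subset fun s _ => em (φ s.toPt = φ s₀.toPt)

variable [E₂.IsElliptic]

/-- A map given by polynomials in the affine coordinates outside finitely many points is regular
somewhere. -/
lemma exists_isRegularAt {g : Pt E₂ → Pt E₃} (B : Fin 3 → MvPolynomial (Fin 2) ℂ)
    (hB : {t : AffinePt E₂ | ¬ (eval t.1 (B 2) ≠ 0 ∧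
      IsCoord (fun i => eval t.1 (B i)) (g t.toPt))}.Finite) : ∃ P, IsRegularAt g P := by
  -- M vanishes at every exceptional point, so the triple M · B is zero there and regularity demands
  -- nothing at those points.
  set M : MvPolynomial (Fin 2) ℂ := ∏ t ∈ hB.toFinset, (X 0 - C (t.1 0)) with hM
  have hMbad : ∀ t : AffinePt E₂, eval t.1 M ≠ 0 →
      eval t.1 (B 2) ≠ 0 ∧ IsCoord (fun i => eval t.1 (B i)) (g t.toPt) := by
    intro t ht
    by_contra hcon
    apply ht
    rw [hM, map_prod]
    exact Finset.prod_eq_zero (hB.mem_toFinset.mpr hcon) (by simp)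
  obtain ⟨t₀, ht₀⟩ : ∃ t : AffinePt E₂, eval t.1 M ≠ 0 := by
    obtain ⟨a, ha⟩ := (hB.toFinset.finite_toSet.image fun t => t.1 0).infinite_compl.nonempty
    obtain ⟨t, rfl⟩ := fst_surjective E₂ a
    refine ⟨t, ?_⟩
    rw [hM, map_prod, Finset.prod_ne_zero_iff]
    intro s hs h
    refine ha ⟨s, hs, ?_⟩
    simp only [map_sub, eval_X, eval_C, sub_eq_zero] at h
    exact h.symm
  choose n₀ hn using fun i => exists_isHomogeneous_eval (M * B i)
  have hle : ∀ i, n₀ i ≤ n₀ 0 + n₀ 1 + n₀ 2 := fun i => by fin_cases i <;> simp <;> omega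
  choose F hF hFe using fun i => hn i (n₀ 0 + n₀ 1 + n₀ 2) (hle i)
  set d := n₀ 0 + n₀ 1 + n₀ 2 with hd
  -- The extra factor `X 2` makes the triple vanish at the point at infinity, about which B says
  -- nothing.
  have hFh : ∀ i, (F i * X 2).IsHomogeneous (d + 1) := fun i => (hF i).mul (isHomogeneous_X _ _)
  have hev : ∀ (u : ℂ) (t : Fin 2 → ℂ), evalTriple (fun i => F i * X 2) (u • projCoord t) =
      (u ^ (d + 1) * eval t M) • fun i => eval t (B i) := by
    intro u t
    funext i
    have h1 := hFe i (t 0) (t 1)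
    have h2 : ![t 0, t 1] = t := by
      funext j
      fin_cases j <;> rfl
    rw [h2, map_mul] at h1
    have h3 : eval (u • projCoord t) (F i * X 2) = u ^ (d + 1) * eval (projCoord t) (F i * X 2) :=
      eval_smul_of_isHomogeneous (hFh i) u (projCoord t)
    simp only [evalTriple, h3, Pi.smul_apply, smul_eq_mul]
    rw [map_mul]
    simp only [projCoord, h1, eval_X]
    simp
    ring
  refine ⟨t₀.toPt, d + 1, fun i => F i * X 2, hFh, fun p hp => ?_, fun Q q hq hne => ?_⟩
  · obtain ⟨u, hu⟩ := (hp.equiv_iff t₀.isCoord).mpr rfl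
    have hu' : (u : ℂ) • projCoord t₀.1 = p := hu
    rw [← hu', hev]
    intro h
    have h2 := congrFun h 2
    simp only [Pi.smul_apply, smul_eq_mul, Pi.zero_apply] at h2
    exact mul_ne_zero (mul_ne_zero (pow_ne_zero _ u.ne_zero) ht₀) (hMbad t₀ ht₀).1 h2
  · have hz : q 2 ≠ 0 := by
      intro hz
      apply hne
      funext i
      simp [evalTriple, hz]
    obtain ⟨t, rfl, ht⟩ := exists_smul_projCoord hq hz
    rw [ht, hev] at hne ⊢
    have hc : q 2 ^ (d + 1) * eval t.1 M ≠ 0 := fun h => hne (by rw [h, zero_smul])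
    exact (hMbad t (right_ne_zero_of_mul hc)).2.of_equiv
      (Projective.smul_equiv _ (isUnit_iff_ne_zero.mpr hc))

/-- A homomorphism that is regular at one point is a morphism. -/
lemma isMorphism_of_isRegularAt [E₃.IsElliptic] {g : Pt E₂ →+ Pt E₃} {P : Pt E₂}
    (h : IsRegularAt g P) : IsMorphism g := by
  intro Q
  -- Translation moves Q to P, using g(R) = g(R + (P − Q)) − g(P − Q).
  have h1 : IsRegularAt (fun R : Pt E₂ => R + (P - Q)) Q :=
    isRegularAt_add (isRegularAt_id Q) (isRegularAt_const _ Q)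
  have h2 : IsRegularAt (fun R => g (R + (P - Q))) Q :=
    IsRegularAt.comp (f := fun R : Pt E₂ => R + (P - Q)) (by simpa using h) h1
  have h3 := isRegularAt_add h2 (isRegularAt_const (-g (P - Q)) Q)
  have h4 : (fun R => g (R + (P - Q)) + -g (P - Q)) = g := by
    funext R
    rw [map_add]
    abel
  rwa [h4] at h3

/-- A homomorphism whose composition with a surjective homomorphism of algebraic groups with finite
kernel is a morphism is itself a morphism. -/
lemma isMorphism_of_comp [E₃.IsElliptic] {φ : Pt E₁ →+ Pt E₂} (hφ : IsMorphism φ)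
    (hsurj : Function.Surjective φ) (hker : (φ.ker : Set (Pt E₁)).Finite) {g : Pt E₂ →+ Pt E₃}
    (hg : IsMorphism (g.comp φ)) : IsMorphism g := by
  by_cases hg0 : g.comp φ = 0
  · have : g = 0 := by
      ext Q : 1
      obtain ⟨P, rfl⟩ := hsurj Q
      exact DFunLike.congr_fun hg0 P
    rw [this]
    exact fun P => isRegularAt_const 0 P
  have hφ0 : φ ≠ 0 := by
    rintro rfl
    exact hg0 (AddMonoidHom.comp_zero g)
  obtain ⟨A, hA2, hA⟩ := exists_affine_coords hφ hφ0
  obtain ⟨H, hH2, hH⟩ := exists_affine_coords hg hg0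
  set c := genericPt E₁
  set w : Fin 2 → E₁.toAffine.FunctionField := fun i => aeval c (A i.castSucc) / aeval c (A 2)
  have halg : Algebra.IsAlgebraic (IntermediateField.adjoin ℂ (Set.range w))
      E₁.toAffine.FunctionField := by
    obtain ⟨i, hi⟩ := exists_transcendental_coord hker hA2 hA
    exact isAlgebraic_of_transcendental (trdeg_functionField_le E₁)
      (IntermediateField.subset_adjoin _ _ ⟨i, rfl⟩) hi
  have hW : aeval c (weierstrassPoly E₁) = 0 := by
    rw [aeval_genericPt, aeval_coordGen_weierstrassPoly, map_zero]
  have key : ∀ j : Fin 2, ∃ p q : MvPolynomial (Fin 2) ℂ, aeval w q ≠ 0 ∧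
      aeval c (H j.castSucc) / aeval c (H 2) * aeval w q = aeval w p := by
    intro j
    refine exists_aeval_mul_eq_of_forall (weierstrassPoly E₁) (A 2) (H 2) (H j.castSucc)
      (fun i : Fin 2 => A i.castSucc) c hW hA2 hH2 halg ?_
    intro s t hs ht hsD htD hsG htG hst
    let s' : AffinePt E₁ := ⟨s, (eval_weierstrassPoly E₁ s).mp hs⟩
    let t' : AffinePt E₁ := ⟨t, (eval_weierstrassPoly E₁ t).mp ht⟩
    have h1 : φ s'.toPt = φ t'.toPt := ((hA s' hsD).equiv_iff (hA t' htD)).mp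
      (Projective.equiv_of_X_eq_of_Y_eq hsD htD (hst 0) (hst 1))
    have h2 : g.comp φ s'.toPt = g.comp φ t'.toPt := congrArg g h1
    have h3 := ((hH s' hsG).equiv_iff (hH t' htG)).mpr h2
    fin_cases j
    · exact Projective.X_eq_of_equiv h3
    · exact Projective.Y_eq_of_equiv h3
  choose p q hq hpq using key
  have hw : ∀ i, toGerm E₁ (w i) = ((fun s => eval s.1 (A i.castSucc) / eval s.1 (A 2) :
      AffinePt E₁ → ℂ) : CofiniteGerm E₁) := fun i => toGerm_div E₁ hA2
  have hqev := fun j => eventually_ne_zero_of_toGerm E₁ (hq j) (toGerm_aeval E₁ hw (q j))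
  have hpqev : ∀ j : Fin 2, ∀ᶠ s : AffinePt E₁ in Filter.cofinite,
      eval s.1 (H j.castSucc) / eval s.1 (H 2) *
        eval (fun i : Fin 2 => eval s.1 (A i.castSucc) / eval s.1 (A 2)) (q j) =
        eval (fun i : Fin 2 => eval s.1 (A i.castSucc) / eval s.1 (A 2)) (p j) := by
    intro j
    have h := congrArg (toGerm E₁) (hpq j)
    rw [map_mul, toGerm_div E₁ hH2, toGerm_aeval E₁ hw, toGerm_aeval E₁ hw] at h
    exact Filter.Germ.coe_eq.mp h
  -- The affine coordinates of g are p₀/q₀ and p₁/q₁, here over the common denominator q₀q₁. By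
  -- surjectivity, exceptional points of E₂ are images under φ of the finitely many exceptional
  -- points of E₁.
  obtain ⟨P, hP⟩ := exists_isRegularAt (g := g) ![p 0 * q 1, p 1 * q 0, q 0 * q 1] (by
    have hall := (eventually_ne_zero E₁ hA2).and ((eventually_ne_zero E₁ hH2).and
      ((hqev 0).and ((hqev 1).and ((hpqev 0).and (hpqev 1)))))
    refine Set.Finite.of_finite_image (((Filter.eventually_cofinite.mp hall).image
      fun s => φ s.toPt).subset ?_) AffinePt.toPt_injective.injOn
    rintro _ ⟨t, ht, rfl⟩
    obtain ⟨P, hP⟩ := hsurj t.toPt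
    have hP0 : P ≠ 0 := by
      rintro rfl
      exact t.toPt_ne_zero (hP.symm.trans (map_zero φ))
    obtain ⟨s, rfl⟩ := exists_toPt_eq hP0
    refine ⟨s, fun hs => ht ?_, hP⟩
    obtain ⟨k1, k2, k3, k4, k5, k6⟩ := hs
    have ht1 := t.isCoord
    rw [← hP] at ht1
    have hst := ((hA s k1).equiv_iff ht1).mpr rfl
    have e0 : eval s.1 (A 0) * 1 = t.1 0 * eval s.1 (A 2) := Projective.X_eq_of_equiv hst
    have e1 : eval s.1 (A 1) * 1 = t.1 1 * eval s.1 (A 2) := Projective.Y_eq_of_equiv hst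
    have et : (fun i : Fin 2 => eval s.1 (A i.castSucc) / eval s.1 (A 2)) = t.1 := by
      funext i
      rw [div_eq_iff k1]
      fin_cases i
      · simpa using e0
      · simpa using e1
    rw [et] at k3 k4 k5 k6
    have hcoord := hH s k2
    have hne : eval t.1 (![p 0 * q 1, p 1 * q 0, q 0 * q 1] 2) ≠ 0 := by
      simpa using ⟨k3, k4⟩
    refine ⟨hne, ?_⟩
    have hcomp : g.comp φ s.toPt = g t.toPt := by rw [← hP]; rfl
    rw [hcomp] at hcoord
    have k5' : eval s.1 (H 0) * eval t.1 (q 0) = eval t.1 (p 0) * eval s.1 (H 2) := by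
      rw [← k5]
      change _ = eval s.1 (H 0) / eval s.1 (H 2) * _ * _
      field_simp
    have k6' : eval s.1 (H 1) * eval t.1 (q 1) = eval t.1 (p 1) * eval s.1 (H 2) := by
      rw [← k6]
      change _ = eval s.1 (H 1) / eval s.1 (H 2) * _ * _
      field_simp
    refine hcoord.of_mul_eq k2 hne ?_ ?_
    · simp
      linear_combination (-eval t.1 (q 1)) * k5'
    · simp
      linear_combination (-eval t.1 (q 0)) * k6')
  exact isMorphism_of_isRegularAt hP

end Homomorphisms

/-! ### Kernels of isogenies, the dual isogeny and transport of endomorphisms -/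

section Isogeny

variable {E₁ E₂ : WeierstrassCurve ℂ} [E₂.IsElliptic]

/-- As n ≠ 0, only finitely many points have an empty fibre, so the image is a subgroup with finite
complement. -/
lemma Isogeny.HasDegree.surjective {φ : Isogeny E₁ E₂} {n : ℕ} (h : φ.HasDegree n) (hn : n ≠ 0) :
    Function.Surjective φ.toHom := by
  rw [← AddMonoidHom.range_eq_top]
  refine addSubgroup_eq_top_of_finite_compl (h.subset ?_)
  intro Q hQ hcard
  have he : φ.toHom ⁻¹' {Q} = ∅ := by
    ext P
    simp only [Set.mem_preimage, Set.mem_singleton_iff, Set.mem_empty_iff_false, iff_false]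
    exact fun hP => hQ ⟨P, hP⟩
  rw [he, Set.encard_empty] at hcard
  exact hn (by exact_mod_cast hcard.symm)

/-- A fibre with exactly n points is a translate of the kernel. -/
lemma Isogeny.HasDegree.encard_ker {φ : Isogeny E₁ E₂} {n : ℕ} (h : φ.HasDegree n) (hn : n ≠ 0) :
    (φ.toHom.ker : Set (Pt E₁)).encard = n := by
  obtain ⟨Q, hQ⟩ := h.infinite_compl.nonempty
  obtain ⟨P, rfl⟩ := h.surjective hn Q
  have hQ' : (φ.toHom ⁻¹' {φ.toHom P}).encard = n := by
    by_contra hcon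
    exact hQ hcon
  rw [← hQ', ← (add_left_injective P).encard_image]
  congr 1
  ext R
  simp only [Set.mem_image, SetLike.mem_coe, AddMonoidHom.mem_ker, Set.mem_preimage,
    Set.mem_singleton_iff]
  constructor
  · rintro ⟨S, hS, rfl⟩
    simp [hS]
  · intro hR
    exact ⟨R - P, by simp [hR], by simp⟩

lemma Isogeny.HasDegree.nsmul_eq_zero {φ : Isogeny E₁ E₂} {n : ℕ} (h : φ.HasDegree n)
    (hn : n ≠ 0) {P : Pt E₁} (hP : P ∈ φ.toHom.ker) : n • P = 0 := by
  have hc : Nat.card φ.toHom.ker = n := by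
    have := h.encard_ker hn
    have h2 : (φ.toHom.ker : Set (Pt E₁)).ncard = n := by rw [Set.ncard, this]; rfl
    exact h2
  have h3 : Nat.card φ.toHom.ker • (⟨P, hP⟩ : φ.toHom.ker) = 0 := card_nsmul_eq_zero'
  rw [hc] at h3
  exact congrArg Subtype.val h3

variable [E₁.IsElliptic]

lemma isMorphism_nsmul (n : ℕ) : IsMorphism (n • AddMonoidHom.id (Pt E₁) : Pt E₁ →+ Pt E₁) := by
  induction n with
  | zero =>
    rw [zero_smul]
    exact fun P => isRegularAt_const 0 P
  | succ n ih =>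
    rw [succ_nsmul]
    exact fun P => isRegularAt_add (ih P) (isRegularAt_id P)

/-- The dual isogeny. -/
lemma Isogeny.HasDegree.exists_dual {φ : Isogeny E₁ E₂} {n : ℕ} (h : φ.HasDegree n) (hn : n ≠ 0) :
    ∃ ψ : Pt E₂ →+ Pt E₁, IsMorphism ψ ∧ (∀ P, ψ (φ.toHom P) = n • P) ∧
      ∀ Q, φ.toHom (ψ Q) = n • Q := by
  have hsurj := h.surjective hn
  let f : Pt E₁ →+ Pt E₁ := n • AddMonoidHom.id (Pt E₁)
  have hle : φ.toHom.ker ≤ f.ker := fun P hP => h.nsmul_eq_zero hn hP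
  -- φ identifies E₂(ℂ) with E₁(ℂ) modulo its kernel, which multiplication by n kills by Lagrange's
  -- theorem.
  let ψ : Pt E₂ →+ Pt E₁ := φ.toHom.liftOfSurjective hsurj ⟨f, hle⟩
  have hψ : ψ.comp φ.toHom = f := AddMonoidHom.liftOfRightInverse_comp _ _ _ ⟨f, hle⟩
  have hψ' : ∀ P, ψ (φ.toHom P) = n • P := fun P => DFunLike.congr_fun hψ P
  have hfin : (φ.toHom.ker : Set (Pt E₁)).Finite :=
    Set.finite_of_encard_eq_coe (h.encard_ker hn)
  refine ⟨ψ, isMorphism_of_comp φ.isMorphism hsurj hfin (by rw [hψ]; exact isMorphism_nsmul n),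
    hψ', fun Q => ?_⟩
  obtain ⟨P, rfl⟩ := hsurj Q
  rw [hψ', map_nsmul]

lemma End.two_dvd_iff {f : End E₁} :
    (2 : End E₁) ∣ f ↔ ∃ g : Pt E₁ →+ Pt E₁, IsMorphism g ∧ ∀ P, (f : AddMonoid.End (Pt E₁)) P =
      g P + g P := by
  constructor
  · rintro ⟨g, rfl⟩
    refine ⟨g.1, g.2, fun P => ?_⟩
    rw [two_mul]
    rfl
  · rintro ⟨g, hg, h⟩
    refine ⟨⟨g, hg⟩, ?_⟩
    rw [two_mul]
    apply Subtype.ext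
    ext P : 1
    exact h P

/-- If there are homomorphisms in both directions whose compositions are multiplication by an odd
integer, the reductions modulo `2` of the endomorphism rings are both reduced or both not. -/
lemma HasSqZeroModTwo.of_dual {φ : Pt E₁ →+ Pt E₂} {ψ : Pt E₂ →+ Pt E₁} (hφ : IsMorphism φ)
    (hψ : IsMorphism ψ) {n : ℕ} (hn : Odd n) (h1 : ∀ P, ψ (φ P) = n • P)
    (h : HasSqZeroModTwo (End E₁)) : HasSqZeroModTwo (End E₂) := by
  obtain ⟨α, hα, hαα⟩ := h
  rw [End.two_dvd_iff] at hα hαα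
  obtain ⟨β, hβ, hαβ⟩ := hαα
  have hαβ' : ∀ P, α.1 (α.1 P) = β P + β P := hαβ
  have hm : ∀ {g : Pt E₁ →+ Pt E₁}, IsMorphism g → IsMorphism (φ.comp (g.comp ψ)) :=
    fun hg P => (hφ _).comp ((hg _).comp (hψ P))
  have hm' : ∀ {g : Pt E₂ →+ Pt E₂}, IsMorphism g → IsMorphism (ψ.comp (g.comp φ)) :=
    fun hg P => (hψ _).comp ((hg _).comp (hφ P))
  let α' : Pt E₁ →+ Pt E₁ := α.1
  refine ⟨⟨φ.comp (α'.comp ψ), hm α.2⟩, fun hcon => hα ?_, End.two_dvd_iff.mpr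
    ⟨φ.comp ((n • β).comp ψ), hm ?_, fun Q => ?_⟩⟩
  · obtain ⟨γ, hγ, hα'⟩ := End.two_dvd_iff.mp hcon
    have hα'' : ∀ Q, φ (α.1 (ψ Q)) = γ Q + γ Q := hα'
    obtain ⟨k, hk⟩ : Odd (n * n) := hn.mul hn
    let δ : End E₁ := ⟨ψ.comp (γ.comp φ), hm' hγ⟩
    -- With n² = 2k + 1 and n²α = 2δ, one gets α = 2(δ − kα), contradicting the choice of α.
    refine ⟨(δ - k • α : End E₁).1, (δ - k • α : End E₁).2, fun P => ?_⟩
    have e1 : ψ (γ (φ P)) + ψ (γ (φ P)) = (n * n) • α.1 P := by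
      rw [← map_add, ← hα'', h1, h1, map_nsmul, mul_smul]
    change α.1 P = (ψ (γ (φ P)) - k • α.1 P) + (ψ (γ (φ P)) - k • α.1 P)
    rw [sub_add_sub_comm, e1, hk, ← two_nsmul, ← mul_nsmul', add_nsmul, one_nsmul]
    abel
  · have : n • β = (n • AddMonoidHom.id (Pt E₁)).comp β := rfl
    rw [this]
    exact fun P => (isMorphism_nsmul n _).comp (hβ P)
  · change φ (α.1 (ψ (φ (α.1 (ψ Q))))) = φ (n • β (ψ Q)) + φ (n • β (ψ Q))
    rw [h1, map_nsmul, hαβ', ← map_add φ, nsmul_add]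

end Isogeny

end ComplexEllipticCurve

end

/-- If `φ : E₁ → E₂` is an isogeny of odd degree `n` between complex elliptic curves with complex
multiplication, then `E₁` is odd (resp. even) if and only if `E₂` is odd (resp. even). -/
theorem proposition1p4 (E₁ E₂ : WeierstrassCurve ℂ) [E₁.IsElliptic] [E₂.IsElliptic]
    (hCM₁ : ComplexEllipticCurve.HasCM E₁) (hCM₂ : ComplexEllipticCurve.HasCM E₂)
    (φ : ComplexEllipticCurve.Isogeny E₁ E₂) (n : ℕ) (hdeg : φ.HasDegree n) (hn : Odd n) :
    (ComplexEllipticCurve.IsOdd E₁ ↔ ComplexEllipticCurve.IsOdd E₂) ∧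
      (ComplexEllipticCurve.IsEven E₁ ↔ ComplexEllipticCurve.IsEven E₂) := by
  obtain ⟨ψ, hψ, h1, h2⟩ := hdeg.exists_dual hn.pos.ne'
  have h : ComplexEllipticCurve.HasSqZeroModTwo (ComplexEllipticCurve.End E₁) ↔
      ComplexEllipticCurve.HasSqZeroModTwo (ComplexEllipticCurve.End E₂) :=
    ⟨.of_dual φ.isMorphism hψ hn h1, .of_dual hψ φ.isMorphism hn h2⟩
  rw [ComplexEllipticCurve.isOdd_iff E₁ hCM₁, ComplexEllipticCurve.isOdd_iff E₂ hCM₂,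
    ComplexEllipticCurve.isEven_iff E₁ hCM₁, ComplexEllipticCurve.isEven_iff E₂ hCM₂]
  exact ⟨not_congr h, h⟩
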